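/- Let $n,r\in\mathbb N$, where $\mathbb N=\{0,1,2,\dots\}$. Let $\mathfrak q(n)$ be the queer Lie superalgebra over $\mathbb Q$, consisting of the matrices $\begin{pmatrix}A&B\\B&A\end{pmatrix}$ with $A,B\in M_n(\mathbb Q)$ (even if $B=0$, odd if $A=0$) with bracket $[u,v]=uv-(-1)^{\hat u\hat v}vu$ for homogeneous $u,v$ of parities $\hat u,\hat v$. Let $U=U(\mathfrak q(n))$ be its universal enveloping superalgebra, that is, the tensor algebra of $\mathfrak q(n)$ modulo the two-sided ideal generated by the elements $u\otimes v-(-1)^{\hat u\hat v}v\otimes u-[u,v]$ for homogeneous $u,v$. Number the rows and columns by $1,\dots,n,-1,\dots,-n$, and for $1\le i,j\le n$ put $x_{i,j}=E_{i,j}+E_{-i,-j}$, $\bar x_{i,j}=E_{i,-j}+E_{-i,j}$, $h_i=x_{i,i}$, $h_{\bar i}=\bar x_{i,i}$, $x_{i,j}^{(k)}=x_{i,j}^k/k!$ and $\binom{h_i}{k}=h_i(h_i-1)\cdots(h_i-k+1)/k!$ in $U$. Let $U_{\mathbb Z}\subseteq U$ be the $\mathbb Z$-subalgebra generated by $x_{i,i+1}^{(k)},x_{i+1,i}^{(k)},\bar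 x_{i,i+1},\bar x_{i+1,i}$ $(1\le i\le n-1,\ k\in\mathbb N)$ and $\binom{h_i}{k},h_{\bar i}$ $(1\le i\le n,\ k\in\mathbb N)$. Let $I$ be the two-sided ideal of $U$ generated by $h_1+\cdots+h_n-r$ and $h_{\bar i}(h_i-1)\cdots(h_i-r)$ $(1\le i\le n)$, and let $U_{\mathbb Z}(n,r)=U_{\mathbb Z}/(I\cap U_{\mathbb Z})$. Let $M_n(\mathbb N|\mathbb Z_2)'$ be the set of pairs $C=(C_0,C_1)$ of $n\times n$ matrices $C_0=(c^0_{ij})$ over $\mathbb N$ and $C_1=(c^1_{ij})$ over $\mathbb Z_2=\{0,1\}\subset\mathbb N$ such that $C_0$ has zero diagonal. Put $c_{ij}=c^0_{ij}+c^1_{ij}$ and $\chi(C)=(\chi_1(C),\dots,\chi_n(C))$ with $\chi_i(C)=c_{ii}+\sum_{j>i}(c_{ij}+c_{ji})$. Let $\Lambda(n,r)$ be the set of $\lambda\in\mathbb N^n$ with $\lambda_1+\cdots+\lambda_n=r$, and write $\chi(C)\preceq\lambda$ if $\chi_i(C)\le\lambda_i$ for all $i$. With $y_{i,j}=x_{i,j}^{(c^0_{ij})}\,\bar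 x_{i,j}^{\,c^1_{ij}}$, define $$e_{C^+}=\pi^+_{n-1}\cdots\pi^+_1,\quad \pi^+_j=y_{j,j+1}\,y_{j,j+2}\cdots y_{j,n},\qquad f_{C^-}=\pi^-_1\cdots\pi^-_{n-1},\quad \pi^-_j=y_{n,j}\,y_{n-1,j}\cdots y_{j+1,j},$$ $$\overline h_{C^0_1}=h_{\bar 1}^{c^1_{11}}\cdots h_{\bar n}^{c^1_{nn}},\qquad 1_\lambda=\prod_{i=1}^n\binom{h_i}{\lambda_i}.$$ Then $f_{C^-}\,1_\lambda\,\overline h_{C^0_1}\,e_{C^+}\in U_{\mathbb Z}$ for all $C\in M_n(\mathbb N|\mathbb Z_2)'$ and $\lambda\in\Lambda(n,r)$. Denote its image in $U_{\mathbb Z}(n,r)$ by $\mathfrak u_{(C,\lambda)}$. Then $U_{\mathbb Z}(n,r)$ is spanned, as a $\mathbb Z$-module, by the set $$\mathcal B=\{\mathfrak u_{(C,\lambda)}\mid C\in M_n(\mathbb N|\mathbb Z_2)',\ \lambda\in\Lambda(n,r),\ \chi(C)\preceq\lambda\}.$$ -/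

import Mathlib

noncomputable section

namespace QueerSchur

/-- The matrices of the form `(A B; B A)` inside `gl(n|n)`; the rows and columns are indexed by
`Fin n ⊕ Fin n`, where `inl i` stands for the index `i` and `inr i` for the index `-i`. They are
closed under the matrix product, hence under the super commutator; with the super commutator
this is the queer Lie superalgebra `q(n)` over `ℚ`. -/
def queer (n : ℕ) : Subalgebra ℚ (Matrix (Fin n ⊕ Fin n) (Fin n ⊕ Fin n) ℚ) where
  carrier := {X | ∃ A B : Matrix (Fin n) (Fin n) ℚ, X = Matrix.fromBlocks A B B A}
  mul_mem' := by
    rintro _ _ ⟨A, B, rfl⟩ ⟨C, D, rfl⟩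
    refine ⟨A * C + B * D, A * D + B * C, ?_⟩
    rw [Matrix.fromBlocks_multiply, add_comm (B * C), add_comm (B * D)]
  add_mem' := by
    rintro _ _ ⟨A, B, rfl⟩ ⟨C, D, rfl⟩
    exact ⟨A + C, B + D, Matrix.fromBlocks_add ..⟩
  algebraMap_mem' := by
    intro c
    refine ⟨algebraMap ℚ _ c, 0, ?_⟩
    simp only [Algebra.algebraMap_eq_smul_one, ← Matrix.fromBlocks_one, Matrix.fromBlocks_smul,
      smul_zero]

/-- `X` is homogeneous of the given parity: `B = 0` for parity `0`, `A = 0` for parity `1`. -/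
def IsHomogeneous {n : ℕ} (a : Fin 2) (X : queer n) : Prop :=
  if a = 0 then ∃ A : Matrix (Fin n) (Fin n) ℚ, X.1 = Matrix.fromBlocks A 0 0 A
  else ∃ B : Matrix (Fin n) (Fin n) ℚ, X.1 = Matrix.fromBlocks 0 B B 0

/-- The super commutator `[X, Y] = X Y - (-1)^{a b} Y X` of elements of parities `a` and `b`. -/
def superBracket {n : ℕ} (a b : Fin 2) (X Y : queer n) : queer n :=
  X * Y - (-1 : ℚ) ^ ((a : ℕ) * (b : ℕ)) • (Y * X)

/-- The defining relations of the universal enveloping superalgebra: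
`u ⊗ v - (-1)^{a b} v ⊗ u = [u, v]` for `u`, `v` homogeneous of parities `a`, `b`. -/
inductive EnvRel (n : ℕ) : TensorAlgebra ℚ (queer n) → TensorAlgebra ℚ (queer n) → Prop
  | comm (a b : Fin 2) (u v : queer n) (hu : IsHomogeneous a u) (hv : IsHomogeneous b v) :
      EnvRel n
        (TensorAlgebra.ι ℚ u * TensorAlgebra.ι ℚ v
          - (-1 : ℚ) ^ ((a : ℕ) * (b : ℕ)) • (TensorAlgebra.ι ℚ v * TensorAlgebra.ι ℚ u))
        (TensorAlgebra.ι ℚ (superBracket a b u v))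

/-- The universal enveloping superalgebra `U = U(q(n))` over `ℚ`: the tensor algebra modulo
the two-sided ideal generated by the relations. -/
abbrev U (n : ℕ) : Type := RingQuot (EnvRel n)

/-- The canonical map `q(n) → U(q(n))`. -/
def toU {n : ℕ} (X : queer n) : U n := RingQuot.mkAlgHom ℚ (EnvRel n) (TensorAlgebra.ι ℚ X)

/-- `x_{i,j} = E_{i,j} + E_{-i,-j}`, as an element of `U` (for `i = j` this is `h_i`). -/
def x {n : ℕ} (i j : Fin n) : U n :=
  toU ⟨Matrix.fromBlocks (Matrix.single i j 1) 0 0 (Matrix.single i j 1), _, _, rfl⟩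

/-- `x̄_{i,j} = E_{i,-j} + E_{-i,j}`, as an element of `U` (for `i = j` this is `h_{ī}`). -/
def xbar {n : ℕ} (i j : Fin n) : U n :=
  toU ⟨Matrix.fromBlocks 0 (Matrix.single i j 1) (Matrix.single i j 1) 0, _, _, rfl⟩

/-- The even Cartan element `h_i = E_{i,i} + E_{-i,-i}`. -/
abbrev h {n : ℕ} (i : Fin n) : U n := x i i

/-- The odd Cartan element `h_{ī} = E_{i,-i} + E_{-i,i}`. -/
abbrev hbar {n : ℕ} (i : Fin n) : U n := xbar i i

/-- The divided power `y^{(k)} = y^k / k!`. -/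
def divPow {n : ℕ} (y : U n) (k : ℕ) : U n := ((k.factorial : ℚ)⁻¹) • y ^ k

/-- The binomial `y (y - 1) ⋯ (y - k + 1) / k!`. -/
def binom {n : ℕ} (y : U n) (k : ℕ) : U n :=
  ((k.factorial : ℚ)⁻¹) • ((List.range k).map fun t => y - (t : U n)).prod

/-- The Kostant `ℤ`-form `U_ℤ`: the `ℤ`-subalgebra (subring) of `U` generated by the divided
powers of the simple root vectors `e_i = x_{i,i+1}`, `f_i = x_{i+1,i}`, by the odd simple root
vectors, and by the `h_i` choose `k` and the `h_{ī}`. -/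
def UZ (n : ℕ) : Subring (U n) :=
  Subring.closure
    ({y | ∃ (i j : Fin n) (k : ℕ), (i : ℕ) + 1 = j ∧ (y = divPow (x i j) k ∨ y = divPow (x j i) k)}
      ∪ {y | ∃ i j : Fin n, (i : ℕ) + 1 = j ∧ (y = xbar i j ∨ y = xbar j i)}
      ∪ {y | ∃ (i : Fin n) (k : ℕ), y = binom (h i) k}
      ∪ {y | ∃ i : Fin n, y = hbar i})

/-- The two-sided ideal `I` of `U` generated by `h_1 + ⋯ + h_n - r` and by
`h_{ī} (h_i - 1) ⋯ (h_i - r)` for all `i`. -/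
def idealI (n r : ℕ) : TwoSidedIdeal (U n) :=
  TwoSidedIdeal.span
    ({(∑ i : Fin n, h i) - (r : U n)}
      ∪ {y | ∃ i : Fin n,
          y = hbar i * ((List.range r).map fun t => h i - ((t + 1 : ℕ) : U n)).prod})

/-- The ideal `I ∩ U_ℤ` of `U_ℤ`. -/
def idealIZ (n r : ℕ) : TwoSidedIdeal (UZ n) := (idealI n r).comap (UZ n).subtype

/-- `U_ℤ(n,r) = U_ℤ / (I ∩ U_ℤ)`. -/
abbrev UZnr (n r : ℕ) : Type := (idealIZ n r).ringCon.Quotient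

/-- The quotient map `U_ℤ → U_ℤ(n,r)`. -/
def toUZnr (n r : ℕ) : UZ n →+* UZnr n r := (idealIZ n r).ringCon.mk'

/-- `M_n(ℕ|ℤ₂) = M_n(ℕ) × M_n(ℤ₂)`, with `ℤ₂ = {0, 1}` read as a subset of `ℕ`. -/
abbrev SMat (n : ℕ) : Type := Matrix (Fin n) (Fin n) ℕ × Matrix (Fin n) (Fin n) (Fin 2)

/-- `M_n(ℕ|ℤ₂)'`: the pairs `C = (C_0, C_1)` such that `C_0` has zero diagonal. -/
def SMat' (n : ℕ) : Set (SMat n) := {C | ∀ i, C.1 i i = 0}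

/-- The sum of the entries at the same place, `a_{ij} = a^0_{ij} + a^1_{ij}`. -/
def entry {n : ℕ} (A : SMat n) (i j : Fin n) : ℕ := A.1 i j + (A.2 i j : ℕ)

/-- `χ_i(A) = a_{ii} + ∑_{j > i} (a_{ij} + a_{ji})`. -/
def chi {n : ℕ} (A : SMat n) (i : Fin n) : ℕ :=
  entry A i i + ∑ j ∈ Finset.Ioi i, (entry A i j + entry A j i)

/-- `Λ(n,r)`: the compositions of `r` into `n` parts, zero parts being allowed. -/
def Comp (n r : ℕ) : Set (Fin n → ℕ) := {lam | ∑ i, lam i = r}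

/-- The factor `x_{i,j}^{(a^0_{ij})} x̄_{i,j}^{a^1_{ij}}`. -/
def factor {n : ℕ} (A : SMat n) (i j : Fin n) : U n :=
  divPow (x i j) (A.1 i j) * xbar i j ^ (A.2 i j : ℕ)

/-- The product over the part of row `j` to the right of the diagonal, in the order
`(j,j+1), …, (j,n)`. -/
def rowProd {n : ℕ} (A : SMat n) (j : Fin n) : U n :=
  (((List.finRange n).filter fun l => j < l).map fun l => factor A j l).prod

/-- The product over the part of column `j` below the diagonal, in the order
`(n,j), …, (j+1,j)`. -/
def colProd {n : ℕ} (A : SMat n) (j : Fin n) : U n :=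
  (((List.finRange n).filter fun l => j < l).reverse.map fun l => factor A l j).prod

/-- `e_{A^+}`: the product of the row products in the order of decreasing row index. -/
def ePlus {n : ℕ} (A : SMat n) : U n := ((List.finRange n).reverse.map (rowProd A)).prod

/-- `f_{A^-}`: the product of the column products in the order of increasing column index. -/
def fMinus {n : ℕ} (A : SMat n) : U n := ((List.finRange n).map (colProd A)).prod

/-- `∏_i (h_i choose b_i)`; its image in `U_ℤ(n,r)` is `1_b` when `b ∈ Λ(n,r)`. -/
def hBinom {n : ℕ} (b : Fin n → ℕ) : U n := ((List.finRange n).map fun i => binom (h i) (b i)).prod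

/-- The product `h_{1̄}^{a^1_{11}} ⋯ h_{n̄}^{a^1_{nn}}`. -/
def hbarProd {n : ℕ} (A : SMat n) : U n :=
  ((List.finRange n).map fun i => hbar i ^ (A.2 i i : ℕ)).prod

/-- The element `f_{C^-} (h choose λ) h̄_{C^0_1} e_{C^+}` of `U`, whose image in `U_ℤ(n,r)`
is `u_{(C,λ)}`. -/
def uLift {n : ℕ} (C : SMat n) (lam : Fin n → ℕ) : U n :=
  fMinus C * hBinom lam * hbarProd C * ePlus C

/-- The set `B` of the elements `u_{(C,λ)}` of `U_ℤ(n,r)` with `C ∈ M_n(ℕ|ℤ₂)'`, `λ ∈ Λ(n,r)`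
and `χ_i(C) ≤ λ_i` for all `i`. -/
def spanningSet (n r : ℕ) : Set (UZnr n r) :=
  {y | ∃ C ∈ SMat' n, ∃ lam ∈ Comp n r, (∀ i, chi C i ≤ lam i) ∧
    ∃ hmem : uLift C lam ∈ UZ n, y = toUZnr n r ⟨uLift C lam, hmem⟩}

end QueerSchur

end

/-! Everything is computed in $U/I$, into which $U_{\mathbb Z}(n,r)$ embeds. Multiplying the odd
generator of $I$ by $h_{\bar i}$, with $h_{\bar i}^2=h_i$, gives $h_i(h_i-1)\cdots(h_i-r)=0$. So the
$h_i$ are simultaneously diagonalizable with eigenvalues in $\{0,\dots,r\}$. Since they sum to $r$,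
the images of the $1_\lambda$ are orthogonal idempotents with sum 1 (`proj_mul_proj`, `sum_proj`),
and a root vector moves them by shifting the weight (`HasWeight.proj_mul`).

Filter by the total exponent of words in divided powers and odd root vectors, with idempotents
counted in degree 0. Commutation formulas of Kostant type show that two letters commute up to sign
modulo lower degree (`exists_swap`), and equal positions merge (`exists_merge`). Hence every word is
an integral multiple of an ordered one modulo lower degree (`exists_ordered`).

The condition $\chi(C)\preceq\lambda$ comes from one vanishing argument (`proj_mul_ev_word_mem`). If
$\chi_i(C)>\lambda_i$, reorder the word so that row $i$ comes first and $h_{\bar i}$ next. The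
idempotent on the left, moved past row $i$, then either has a negative weight or has weight 0 at $i$
and meets $h_{\bar i}$, which kills it (`Y_cartan_mul_proj`). So the word has lower degree, and
induction on the degree concludes (`filt_le_basisSpan`). -/

noncomputable section

namespace QueerSchur

/-! ### Commutation formulas for divided powers in a `ℚ`-algebra. -/

section DividedPowers

variable {R : Type*} [Ring R] [Algebra ℚ R]

/-- The divided power `y^k / k!`, zero for negative exponents. -/
def dpz (y : R) (k : ℤ) : R :=
  if 0 ≤ k then ((k.toNat.factorial : ℚ)⁻¹) • y ^ k.toNat else 0

theorem dpz_natCast (y : R) (k : ℕ) : dpz y k = ((k.factorial : ℚ)⁻¹) • y ^ k := by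
  simp [dpz]

theorem dpz_of_neg (y : R) {k : ℤ} (hk : k < 0) : dpz y k = 0 := if_neg (not_le.2 hk)

@[simp] theorem dpz_zero (y : R) : dpz y 0 = 1 := by simp [dpz]

@[simp] theorem dpz_one (y : R) : dpz y 1 = y := by simp [dpz]

theorem commute_dpz {y z : R} (hyz : Commute y z) (k : ℤ) : Commute y (dpz z k) := by
  unfold dpz
  split_ifs
  · exact (hyz.pow_right _).smul_right _
  · exact Commute.zero_right _

/-- At `k = -1` the coefficient vanishes together with the left side. Integer exponents therefore
spare the later sums all boundary cases. -/
theorem mul_dpz (y : R) (k : ℤ) : y * dpz y k = ((k : ℚ) + 1) • dpz y (k + 1) := by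
  rcases lt_or_ge k 0 with hk | hk
  · rcases eq_or_lt_of_le (Int.add_one_le_of_lt hk) with hk1 | hk1
    · have : (k : ℚ) + 1 = 0 := by exact_mod_cast hk1
      rw [dpz_of_neg _ hk, this]; simp
    · rw [dpz_of_neg _ hk, dpz_of_neg _ hk1]; simp
  · lift k to ℕ using hk
    have : ((k : ℤ) + 1) = ((k + 1 : ℕ) : ℤ) := by push_cast; ring
    rw [this, dpz_natCast, dpz_natCast, mul_smul_comm, ← pow_succ', smul_smul]
    congr 1
    rw [Nat.factorial_succ]
    have := Nat.factorial_ne_zero k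
    push_cast
    field_simp

theorem dpz_mul_dpz (y : R) (a b : ℕ) :
    dpz y a * dpz y b = ((a + b).choose a : ℤ) • dpz y ((a + b : ℕ) : ℤ) := by
  rw [dpz_natCast, dpz_natCast, dpz_natCast, smul_mul_smul_comm, ← pow_add,
    ← Int.cast_smul_eq_zsmul ℚ, smul_smul]
  congr 1
  have h1 := Nat.add_choose_mul_factorial_mul_factorial a b
  have h2 : (((a + b).choose a : ℚ)) * a.factorial * b.factorial = (a + b).factorial := by
    rw [Nat.choose_symm_add]
    exact_mod_cast h1
  have := Nat.factorial_ne_zero a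
  have := Nat.factorial_ne_zero b
  have := Nat.factorial_ne_zero (a + b)
  push_cast
  field_simp
  linarith

/-- Cancellation of a nonzero rational scalar. -/
theorem smul_cancel {y z : R} {q : ℚ} (hq : q ≠ 0) (hyz : q • y = q • z) : y = z := by
  simpa [smul_smul, hq] using congrArg (q⁻¹ • ·) hyz

/-- Moving a divided power of `y` past an element on which the third power of `ad y` vanishes. -/
theorem dpz_mul_of_ad {y v v₁ v₂ : R} (h₀ : y * v = v * y + v₁)
    (h₁ : y * v₁ = v₁ * y + (2 : ℚ) • v₂) (h₂ : y * v₂ = v₂ * y) (k : ℤ) :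
    dpz y k * v = v * dpz y k + v₁ * dpz y (k - 1) + v₂ * dpz y (k - 2) := by
  rcases lt_or_ge k 0 with hk | hk
  · rw [dpz_of_neg _ hk, dpz_of_neg _ (by lia), dpz_of_neg _ (by lia)]; simp
  lift k to ℕ using hk
  induction k with
  | zero =>
    rw [dpz_of_neg (k := _ - 1) _ (by simp), dpz_of_neg (k := _ - 2) _ (by simp)]; simp
  | succ k ih =>
    have hk : ((k : ℚ) + 1) ≠ 0 := by positivity
    have e0 := mul_dpz y k
    have e1 := mul_dpz y (k - 1)
    have e2 := mul_dpz y (k - 2)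
    push_cast at e0 e1 e2 ⊢
    rw [show (k : ℤ) - 1 + 1 = k by ring, show (k : ℚ) - 1 + 1 = k by ring] at e1
    rw [show (k : ℤ) - 2 + 1 = k - 1 by ring, show (k : ℚ) - 2 + 1 = k - 1 by ring] at e2
    rw [show (k : ℤ) + 1 - 1 = k by ring, show (k : ℤ) + 1 - 2 = k - 1 by ring]
    -- Here `v₂` is half of the second commutator, which keeps the formula integral. Multiplying by
    -- `k + 1` turns the goal into a left multiplication of the induction hypothesis by `y`.
    apply smul_cancel hk
    calc ((k : ℚ) + 1) • (dpz y (k + 1) * v)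
        = y * (dpz y k * v) := by rw [← mul_assoc, e0, smul_mul_assoc]
      _ = (y * v) * dpz y k + (y * v₁) * dpz y (k - 1) + (y * v₂) * dpz y (k - 2) := by
          rw [ih]; noncomm_ring
      _ = v * (y * dpz y k) + v₁ * (dpz y k + y * dpz y (k - 1))
            + v₂ * ((2 : ℚ) • dpz y (k - 1) + y * dpz y (k - 2)) := by
          rw [h₀, h₁, h₂]
          simp only [add_mul, mul_add, smul_mul_assoc, mul_smul_comm, mul_assoc]
          abel
      _ = _ := by
          rw [e0, e1, e2]
          simp only [mul_add, smul_add, mul_smul_comm]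
          module

/-- The regrouping of terms behind both product formulas below: each `u t` receives one contribution
from index `t` and one from `t - 1`. -/
theorem sum_shift {M : Type*} [AddCommGroup M] [Module ℚ M] (m : ℕ) (u : ℕ → M) (α β γ : ℕ → ℚ)
    (hα : α (m + 1) = 0) (h0 : α 0 = γ 0) (h : ∀ t, α (t + 1) + β t = γ (t + 1)) :
    ∑ t ∈ Finset.range (m + 1), (α t • u t + β t • u (t + 1)) =
      ∑ t ∈ Finset.range (m + 2), γ t • u t := by
  rw [Finset.sum_add_distrib, Finset.sum_range_succ' (fun t => γ t • u t), ← h0]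
  have : ∑ t ∈ Finset.range (m + 1), α t • u t = ∑ t ∈ Finset.range (m + 2), α t • u t := by
    rw [Finset.sum_range_succ _ (m + 1), hα]; simp
  rw [this, Finset.sum_range_succ', add_right_comm, ← Finset.sum_add_distrib]
  simp only [← add_smul, h]

/-- The product of divided powers of `y` and `z` when `[y, z]` commutes with `y` and `z`. -/
theorem dpz_mul_dpz_of_heisenberg {y z c : R} (h : y * z = z * y + c) (hy : Commute y c)
    (hz : Commute z c) (m : ℕ) (k : ℤ) :
    dpz y m * dpz z k =
      ∑ t ∈ Finset.range (m + 1), dpz z (k - t) * dpz c t * dpz y (m - t) := by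
  -- The roles are exchanged: `z` is the element raised to divided powers, and its commutator with
  -- `y` is `-c`.
  have key : ∀ k, y * dpz z k = dpz z k * y + c * dpz z (k - 1) := fun k => by
    have := dpz_mul_of_ad (y := z) (v := y) (v₁ := -c) (v₂ := 0) (by rw [h]; abel)
      (by simp [hz.eq]) (by simp) k
    rw [this]; simp
  induction m with
  | zero => simp
  | succ m ih =>
    have hk : ((m : ℚ) + 1) ≠ 0 := by positivity
    apply smul_cancel hk
    have e0 := mul_dpz y m
    push_cast at e0 ⊢
    calc ((m : ℚ) + 1) • (dpz y (m + 1) * dpz z k)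
        = y * (dpz y m * dpz z k) := by rw [← mul_assoc, e0, smul_mul_assoc]
      _ = ∑ t ∈ Finset.range (m + 1),
            (((m : ℚ) + 1 - t) • (dpz z (k - t) * dpz c t * dpz y (m + 1 - t)) +
             ((t : ℚ) + 1) • (dpz z (k - (t + 1 : ℕ)) * dpz c (t + 1 : ℕ)
                * dpz y (m + 1 - (t + 1 : ℕ)))) := by
          rw [ih, Finset.mul_sum]
          refine Finset.sum_congr rfl fun t _ => ?_
          have a1 := mul_dpz y (m - t)
          have a2 := mul_dpz c t
          push_cast at a1 a2 ⊢
          rw [show (m : ℤ) - t + 1 = m + 1 - t by ring, show (m : ℚ) - t + 1 = m + 1 - t by ring]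
            at a1
          rw [show (m : ℤ) + 1 - (t + 1) = m - t by ring,
            show k - ((t : ℤ) + 1) = k - t - 1 by ring]
          have c1 : Commute y (dpz c t) := commute_dpz hy _
          have c2 : Commute c (dpz z (k - t - 1)) := commute_dpz hz.symm _
          rw [mul_assoc, ← mul_assoc, key, add_mul, mul_assoc _ y, ← mul_assoc y, c1.eq,
            mul_assoc _ y, a1, c2.eq, mul_assoc _ c, ← mul_assoc c, a2]
          simp only [mul_smul_comm, smul_mul_assoc, mul_assoc]
      _ = _ := by
          rw [sum_shift m (fun t : ℕ => dpz z (k - t) * dpz c t * dpz y (m + 1 - t))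
            (fun t => (m : ℚ) + 1 - t) (fun t => (t : ℚ) + 1) (fun _ => (m : ℚ) + 1)
            (by push_cast; ring) (by simp) (fun t => by push_cast; ring), Finset.smul_sum]

/-- `Ring.choose` is needed because the upper argument in the `sl₂` formula can be negative. -/
theorem choose_shift (N : ℤ) (t : ℕ) :
    ((t : ℚ) + 1) * ((Ring.choose N (t + 1) : ℤ) : ℚ) =
      ((N : ℚ) - t) * ((Ring.choose N t : ℤ) : ℚ) := by
  have h0 := Ring.descPochhammer_eq_factorial_smul_choose N t
  have h1 := Ring.descPochhammer_eq_factorial_smul_choose N (t + 1)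
  rw [← Polynomial.eval_eq_smeval] at h0 h1
  rw [descPochhammer_succ_right, Polynomial.eval_mul, h0] at h1
  have ht : (t.factorial : ℚ) ≠ 0 := by exact_mod_cast Nat.factorial_ne_zero t
  have h2 := congrArg (Int.cast : ℤ → ℚ) h1
  simp only [nsmul_eq_mul, Nat.factorial_succ, Polynomial.eval_sub, Polynomial.eval_X,
    Polynomial.eval_natCast] at h2
  push_cast at h2
  apply mul_left_cancel₀ ht
  linarith

/-- The commutation formula for divided powers in `sl₂`, applied to a weight vector `v` of
weight `wt`. -/
theorem dpz_mul_dpz_of_sl2 {e f H v : R} (hef : e * f = f * e + H)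
    (hHe : H * e = e * H + (2 : ℚ) • e) (hHf : H * f = f * H - (2 : ℚ) • f) (wt : ℤ)
    (hv : H * v = (wt : ℚ) • v) (m : ℕ) (k : ℤ) :
    dpz e m * dpz f k * v =
      ∑ t ∈ Finset.range (m + 1),
        (Ring.choose (wt + m - k) t : ℤ) • (dpz f (k - t) * dpz e (m - t) * v) := by
  have key : ∀ k, e * dpz f k = dpz f k * e + H * dpz f (k - 1) +
      ((k : ℚ) - 1) • dpz f (k - 1) := fun k => by
    have := dpz_mul_of_ad (y := f) (v := e) (v₁ := -H) (v₂ := -f) (by rw [hef]; abel)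
      (by rw [mul_neg, neg_mul, hHf]; module) (by simp) k
    have h2 := mul_dpz f (k - 2)
    rw [show k - 2 + 1 = k - 1 by ring] at h2
    rw [this, neg_mul, neg_mul, h2]
    push_cast
    module
  have hwe : ∀ k, H * (dpz e k * v) = ((wt : ℚ) + 2 * k) • (dpz e k * v) := fun k => by
    have := dpz_mul_of_ad (y := e) (v := H) (v₁ := (-2 : ℚ) • e) (v₂ := 0) (by rw [hHe]; module)
      (by simp) (by simp) k
    have h2 := mul_dpz e (k - 1)
    rw [show k - 1 + 1 = k by ring] at h2
    rw [smul_mul_assoc, h2] at this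
    have h3 : H * dpz e k = dpz e k * H + (2 * k : ℚ) • dpz e k := by
      rw [this, zero_mul]; push_cast; module
    rw [← mul_assoc, h3, add_mul, mul_assoc, hv, mul_smul_comm, smul_mul_assoc]
    module
  have hwf : ∀ k, H * dpz f k = dpz f k * H - (2 * k : ℚ) • dpz f k := fun k => by
    have := dpz_mul_of_ad (y := f) (v := H) (v₁ := (2 : ℚ) • f) (v₂ := 0) (by rw [hHf]; module)
      (by simp) (by simp) k
    have h2 := mul_dpz f (k - 1)
    rw [show k - 1 + 1 = k by ring] at h2
    rw [smul_mul_assoc, h2] at this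
    rw [this, zero_mul]; push_cast; module
  induction m generalizing k with
  | zero => simp
  | succ m ih =>
    have hk : ((m : ℚ) + 1) ≠ 0 := by positivity
    apply smul_cancel hk
    have e0 := mul_dpz e m
    push_cast at e0 ⊢
    set N : ℤ := wt + m - k with hN
    have hNq : (N : ℚ) = wt + m - k := by rw [hN]; push_cast; ring
    calc ((m : ℚ) + 1) • (dpz e (m + 1) * dpz f k * v)
        = e * (dpz e m * dpz f k * v) := by
          rw [← mul_assoc, ← mul_assoc, e0, smul_mul_assoc, smul_mul_assoc]
      _ = ∑ t ∈ Finset.range (m + 1),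
            ((((m : ℚ) + 1 - t) * (Ring.choose N t : ℤ)) •
                (dpz f (k - t) * dpz e (m + 1 - t) * v) +
             (((N : ℚ) + m + 1 - t) * (Ring.choose N t : ℤ)) • (dpz f (k - (t + 1 : ℕ))
                * dpz e (m + 1 - (t + 1 : ℕ)) * v)) := by
          rw [ih, Finset.mul_sum]
          refine Finset.sum_congr rfl fun t _ => ?_
          have a1 := mul_dpz e (m - t)
          push_cast at a1 ⊢
          rw [show (m : ℤ) - t + 1 = m + 1 - t by ring, show (m : ℚ) - t + 1 = m + 1 - t by ring]
            at a1
          rw [show (m : ℤ) + 1 - (t + 1) = m - t by ring,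
            show k - ((t : ℤ) + 1) = k - t - 1 by ring, ← Int.cast_smul_eq_zsmul ℚ, mul_smul_comm,
            mul_assoc, ← mul_assoc, key, hwf, add_mul, add_mul, mul_assoc _ e, ← mul_assoc e, a1,
            sub_mul, mul_assoc _ H, hwe, hNq]
          simp only [mul_smul_comm, smul_mul_assoc, mul_assoc]
          push_cast
          module
      _ = _ := by
          -- The coefficients recombine by Pascal's rule for `Ring.choose` and `choose_shift`;
          -- raising `m` by one raises `N` by one.
          rw [sum_shift m (fun t : ℕ => dpz f (k - t) * dpz e (m + 1 - t) * v)
            (fun t => ((m : ℚ) + 1 - t) * (Ring.choose N t : ℤ))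
            (fun t => ((N : ℚ) + m + 1 - t) * (Ring.choose N t : ℤ))
            (fun t => ((m : ℚ) + 1) * (Ring.choose (N + 1) t : ℤ))
            (by push_cast; ring) (by simp) (fun t => ?_), Finset.smul_sum]
          · refine Finset.sum_congr rfl fun t _ => ?_
            rw [mul_smul, Int.cast_smul_eq_zsmul, hN]
            congr 3; ring
          · rw [Ring.choose_succ_succ]
            have := choose_shift N t
            push_cast
            linarith

end DividedPowers

/-! ### Falling factorials acting on eigenvectors. -/

section EigenInduction

variable {R : Type*} [Ring R]

/-- The falling factorial `y (y - 1) ⋯ (y - k + 1)`. -/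
def falling (y : R) (k : ℕ) : R := ((List.range k).map fun t : ℕ => y - (t : R)).prod

theorem falling_succ (y : R) (k : ℕ) : falling y (k + 1) = falling y k * (y - (k : R)) := by
  simp [falling, List.range_succ]

theorem commute_falling {a b : R} (hab : Commute a b) (k : ℕ) : Commute a (falling b k) := by
  induction k with
  | zero => simp [falling]
  | succ k ih =>
    rw [falling_succ]
    exact ih.mul_right (hab.sub_right (Nat.commute_cast a k))

variable [Algebra ℚ R]

/-- The binomial `y (y - 1) ⋯ (y - k + 1) / k!`. -/
def binomial (y : R) (k : ℕ) : R := ((k.factorial : ℚ)⁻¹) • falling y k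

theorem natCast_mul_eq_smul (k : ℕ) (y : R) : (k : R) * y = (k : ℚ) • y := by
  rw [Nat.cast_smul_eq_nsmul, nsmul_eq_mul]

theorem falling_mul_of_eigen {a y : R} {m : ℕ} (hy : a * y = (m : ℚ) • y) (k : ℕ) :
    falling a k * y = (m.descFactorial k : ℚ) • y := by
  induction k with
  | zero => simp [falling]
  | succ k ih =>
    rw [falling_succ, mul_assoc, sub_mul, hy, natCast_mul_eq_smul, ← sub_smul, mul_smul_comm, ih,
      smul_smul, Nat.descFactorial_succ]
    -- Beyond `m` the natural subtraction truncates, but the descending factorial is already zero.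
    rcases le_or_gt k m with hk | hk
    · rw [Nat.cast_mul, Nat.cast_sub hk]
    · rw [Nat.descFactorial_of_lt hk]; simp

theorem binomial_mul_of_eigen {a y : R} {m : ℕ} (hy : a * y = (m : ℚ) • y) (k : ℕ) :
    binomial a k * y = (m.choose k : ℚ) • y := by
  rw [binomial, smul_mul_assoc, falling_mul_of_eigen hy, smul_smul,
    Nat.descFactorial_eq_factorial_mul_choose, Nat.cast_mul, inv_mul_cancel_left₀]
  exact_mod_cast Nat.factorial_ne_zero k

theorem falling_mul_mem {a : R} {W : Submodule ℚ R} (hW : ∀ y ∈ W, a * y ∈ W) (k : ℕ) {y : R}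
    (hy : y ∈ W) : falling a k * y ∈ W := by
  induction k generalizing y with
  | zero => simpa [falling]
  | succ k ih =>
    rw [falling_succ, mul_assoc]
    apply ih
    rw [sub_mul, natCast_mul_eq_smul]
    exact W.sub_mem (hW y hy) (W.smul_mem _ hy)

/-- An element killed by `a (a - 1) ⋯ (a - m + 1)` is a sum of eigenvectors of `a`. -/
theorem mem_of_falling_mul_eq_zero {a : R} {W M : Submodule ℚ R} (hW : ∀ y ∈ W, a * y ∈ W)
    (hM : ∀ y ∈ W, ∀ k : ℕ, a * y = (k : ℚ) • y → y ∈ M) (m : ℕ) {y : R} (hy : y ∈ W)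
    (h : falling a m * y = 0) : y ∈ M := by
  induction m generalizing y with
  | zero =>
    have : y = 0 := by simpa [falling] using h
    rw [this]; exact M.zero_mem
  | succ m ih =>
    have hcomm : falling a (m + 1) = (a - (m : R)) * falling a m := by
      rw [falling_succ]
      exact ((commute_falling (Commute.refl a) m).sub_left (Nat.cast_commute m _)).eq.symm
    have heig : a * (falling a m * y) = (m : ℚ) • (falling a m * y) := by
      rw [hcomm, mul_assoc, sub_mul, natCast_mul_eq_smul] at h
      exact sub_eq_zero.1 h
    have hmem := falling_mul_mem hW m hy
    have hfac : (m.descFactorial m : ℚ) ≠ 0 := by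
      rw [Nat.descFactorial_self]; exact_mod_cast Nat.factorial_ne_zero m
    -- `falling a m * y` is an eigenvector of eigenvalue `m`, on which `falling a m` acts by `m!`.
    -- Subtracting the right multiple leaves an element killed by the shorter product.
    have h1 : y - (m.descFactorial m : ℚ)⁻¹ • (falling a m * y) ∈ M := by
      apply ih (W.sub_mem hy (W.smul_mem _ hmem))
      rw [mul_sub, mul_smul_comm, falling_mul_of_eigen heig, smul_smul, inv_mul_cancel₀ hfac,
        one_smul, sub_self]
    simpa using M.add_mem h1 (M.smul_mem (m.descFactorial m : ℚ)⁻¹ (hM _ hmem m heig))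

end EigenInduction

/-! ### Weight idempotents in an algebra satisfying the relations of `U / I`. -/

/-- Elements of a `ℚ`-algebra that satisfy the defining relations of `U(q(n)) / I`. -/
structure SchurData (n r : ℕ) (R : Type*) [Ring R] [Algebra ℚ R] where
  X : Fin n → Fin n → R
  Y : Fin n → Fin n → R
  XX : ∀ i j k l, X i j * X k l = X k l * X i j +
    ((if j = k then X i l else 0) - (if i = l then X k j else 0))
  XY : ∀ i j k l, X i j * Y k l = Y k l * X i j +
    ((if j = k then Y i l else 0) - (if i = l then Y k j else 0))
  YY : ∀ i j k l, Y i j * Y k l = - (Y k l * Y i j) +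
    ((if j = k then X i l else 0) + (if i = l then X k j else 0))
  sum_X : ∑ i, X i i = (r : R)
  cartan : ∀ i, Y i i * ((List.range r).map fun t => X i i - ((t + 1 : ℕ) : R)).prod = 0

namespace SchurData

variable {n r : ℕ} {R : Type*} [Ring R] [Algebra ℚ R] (D : SchurData n r R)

theorem commute_cartan (i j : Fin n) : Commute (D.X i i) (D.X j j) := by
  rw [Commute, SemiconjBy, D.XX]
  by_cases h : i = j <;> simp [h]

/-- The supercommutator of an odd element with itself is twice its square. -/
theorem Y_mul_self (i j : Fin n) : D.Y i j * D.Y i j = if i = j then D.X i i else 0 := by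
  have := D.YY i j i j
  apply smul_cancel (two_ne_zero (α := ℚ))
  rw [two_smul]
  nth_rewrite 1 [this]
  by_cases h : i = j
  · subst h; simp [two_smul]
  · simp [h, Ne.symm h]

/-- Left multiplication of the relation `cartan` by `Y i i` supplies the missing factor, as `Y i i`
squares to `X i i`. -/
theorem falling_cartan (i : Fin n) : falling (D.X i i) (r + 1) = 0 := by
  have h1 : D.Y i i * D.Y i i = D.X i i := by simp [Y_mul_self]
  have := congrArg (D.Y i i * ·) (D.cartan i)
  simp only [mul_zero, ← mul_assoc, h1] at this
  rw [← this, falling, List.range_succ_eq_map]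
  simp [Function.comp_def]

/-- `y` is a weight vector of weight `μ`. -/
def Eigen (μ : Fin n → ℤ) (y : R) : Prop := ∀ i, D.X i i * y = (μ i : ℚ) • y

/-- Elements of `R` are determined by their action on weight vectors. -/
theorem eq_of_eigen {z z' : R} (h : ∀ μ : Fin n → ℕ, ∑ i, μ i = r → ∀ y,
    D.Eigen (fun i => μ i) y → z * y = z' * y) : z = z' := by
  rw [← sub_eq_zero]
  -- The eigenvector conditions are removed one index at a time, each removal decomposing `y` into
  -- eigenvectors of one more Cartan element. With no condition left, `y = 1` is allowed.
  have key : ∀ S : Finset (Fin n), (∀ μ : Fin n → ℕ, ∀ y,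
      (∀ i ∈ S, D.X i i * y = (μ i : ℚ) • y) → (z - z') * y = 0) → z - z' = 0 := by
    intro S
    induction S using Finset.induction_on with
    | empty => intro h; simpa using h 0 1
    | insert a S ha ih =>
      intro h
      apply ih
      intro μ y hy
      let W : Submodule ℚ R :=
        { carrier := {y | ∀ i ∈ S, D.X i i * y = (μ i : ℚ) • y}
          add_mem' := fun hu hv i hi => by rw [mul_add, hu i hi, hv i hi, smul_add]
          zero_mem' := fun i _ => by simp
          smul_mem' := fun c u hu i hi => by rw [mul_smul_comm, hu i hi, smul_comm] }
      refine mem_of_falling_mul_eq_zero (a := D.X a a) (W := W)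
        (M := LinearMap.ker (LinearMap.mulLeft ℚ (z - z'))) ?_ ?_ (r + 1) hy
        (by rw [falling_cartan, zero_mul])
      · intro u hu i hi
        rw [← mul_assoc, (D.commute_cartan i a).eq, mul_assoc, hu i hi, mul_smul_comm]
      · intro u hu k hk
        apply h (Function.update μ a k)
        intro i hi
        rcases Finset.mem_insert.1 hi with rfl | hi
        · simpa using hk
        · rw [Function.update_of_ne (ne_of_mem_of_not_mem hi ha)]
          exact hu i hi
  apply key Finset.univ
  intro μ y hy
  -- A nonzero weight vector has weight of total `r`, because the Cartan elements sum to `r`.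
  by_cases hμ : ∑ i, μ i = r
  · rw [sub_mul, h μ hμ y fun i => by simpa using hy i (Finset.mem_univ i), sub_self]
  · have h1 : (∑ i, D.X i i) * y = ((∑ i, μ i : ℕ) : ℚ) • y := by
      rw [Finset.sum_mul, Nat.cast_sum, Finset.sum_smul]
      exact Finset.sum_congr rfl fun i hi => hy i hi
    rw [D.sum_X, natCast_mul_eq_smul] at h1
    by_contra hne
    have hy0 : y ≠ 0 := by rintro rfl; simp at hne
    have := smul_left_injective ℚ hy0 h1
    exact hμ (by exact_mod_cast this.symm)

/-- The product of the binomials of the Cartan elements. -/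
def cartanBinom (b : Fin n → ℕ) : R := ((List.finRange n).map fun i => binomial (D.X i i) (b i)).prod

theorem cartanBinom_mul_of_eigen {μ : Fin n → ℕ} {y : R} (hy : D.Eigen (fun i => μ i) y)
    (b : Fin n → ℕ) : D.cartanBinom b * y = (∏ i, (μ i).choose (b i) : ℕ) • y := by
  have key : ∀ L : List (Fin n), (L.map fun i => binomial (D.X i i) (b i)).prod * y =
      ((L.map fun i => (μ i).choose (b i)).prod : ℕ) • y := by
    intro L
    induction L with
    | nil => simp
    | cons a L ih =>
      rw [List.map_cons, List.prod_cons, mul_assoc, ih, mul_smul_comm,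
        binomial_mul_of_eigen (by simpa using hy a), Nat.cast_smul_eq_nsmul, smul_smul,
        List.map_cons, List.prod_cons, mul_comm]
  rw [cartanBinom, key, Fin.prod_univ_def]

/-- Two distinct compositions of the same number must satisfy `μ i < b i` somewhere, and that
binomial vanishes. So `cartanBinom b` acts on weight vectors as the indicator of the weight `b`. -/
theorem prod_choose_eq {μ b : Fin n → ℕ} (hμ : ∑ i, μ i = r) (hb : ∑ i, b i = r) :
    ∏ i, (μ i).choose (b i) = if μ = b then 1 else 0 := by
  split_ifs with h
  · simp [h]
  · have : ∃ i, μ i < b i := by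
      by_contra! hle
      exact h (funext fun i =>
        ((Finset.sum_eq_sum_iff_of_le fun i _ => hle i).1 (hb.trans hμ.symm) i
          (Finset.mem_univ i)).symm)
    obtain ⟨i, hi⟩ := this
    exact Finset.prod_eq_zero (Finset.mem_univ i) (Nat.choose_eq_zero_of_lt hi)

/-- The projection to the weight space of weight `μ`; zero if `μ` is not a composition of `r`. -/
def proj (μ : Fin n → ℤ) : R :=
  if (∀ i, 0 ≤ μ i) ∧ ∑ i, μ i = r then D.cartanBinom fun i => (μ i).toNat else 0

theorem proj_natCast {b : Fin n → ℕ} (hb : ∑ i, b i = r) :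
    D.proj (fun i => b i) = D.cartanBinom b := by
  rw [proj, if_pos]
  · simp
  · exact ⟨fun i => by positivity, by exact_mod_cast hb⟩

theorem proj_eq_zero {μ : Fin n → ℤ} {i : Fin n} (h : μ i < 0) : D.proj μ = 0 :=
  if_neg fun h' => absurd (h'.1 i) (not_le.2 h)

theorem exists_of_proj_ne_zero {μ : Fin n → ℤ} (h : D.proj μ ≠ 0) :
    ∃ b : Fin n → ℕ, ∑ i, b i = r ∧ μ = fun i => (b i : ℤ) := by
  rw [proj] at h
  have h' := (ite_ne_right_iff.1 h).1
  refine ⟨fun i => (μ i).toNat, ?_, funext fun i => (Int.toNat_of_nonneg (h'.1 i)).symm⟩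
  zify
  rw [← h'.2]
  exact Finset.sum_congr rfl fun i _ => Int.toNat_of_nonneg (h'.1 i)

theorem proj_mul_of_eigen {μ : Fin n → ℕ} (hμ : ∑ i, μ i = r) {y : R}
    (hy : D.Eigen (fun i => μ i) y) (ν : Fin n → ℤ) :
    D.proj ν * y = if (fun i => (μ i : ℤ)) = ν then y else 0 := by
  by_cases hν : D.proj ν = 0
  · rw [hν, zero_mul, eq_comm, ite_eq_right_iff]
    rintro rfl
    rw [D.proj_natCast hμ] at hν
    have := D.cartanBinom_mul_of_eigen hy μ
    rw [hν, prod_choose_eq hμ hμ] at this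
    simpa using this.symm
  · obtain ⟨b, hb, rfl⟩ := D.exists_of_proj_ne_zero hν
    rw [D.proj_natCast hb, D.cartanBinom_mul_of_eigen hy, prod_choose_eq hμ hb]
    have : ((fun i => (μ i : ℤ)) = fun i => (b i : ℤ)) ↔ μ = b := by
      simp [funext_iff]
    simp [this]

theorem cartan_mul_proj (i : Fin n) (ν : Fin n → ℤ) :
    D.X i i * D.proj ν = (ν i : ℚ) • D.proj ν := by
  apply D.eq_of_eigen
  intro μ hμ y hy
  rw [smul_mul_assoc, mul_assoc, D.proj_mul_of_eigen hμ hy]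
  split_ifs with h
  · subst h; exact hy i
  · simp

theorem proj_mul_cartan (i : Fin n) (ν : Fin n → ℤ) :
    D.proj ν * D.X i i = (ν i : ℚ) • D.proj ν := by
  apply D.eq_of_eigen
  intro μ hμ y hy
  rw [smul_mul_assoc, mul_assoc, hy i, mul_smul_comm, D.proj_mul_of_eigen hμ hy]
  split_ifs with h
  · subst h; rfl
  · simp

theorem proj_mul_proj (μ ν : Fin n → ℤ) : D.proj μ * D.proj ν = if μ = ν then D.proj ν else 0 := by
  by_cases hν : D.proj ν = 0
  · simp [hν]
  · obtain ⟨b, hb, rfl⟩ := D.exists_of_proj_ne_zero hν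
    rw [D.proj_mul_of_eigen hb fun i => D.cartan_mul_proj i _]
    simp [eq_comm]

/-- The compositions of `r` into `n` parts. -/
def weights (n r : ℕ) : Finset (Fin n → ℕ) := Finset.piAntidiag Finset.univ r

theorem mem_weights {μ : Fin n → ℕ} : μ ∈ weights n r ↔ ∑ i, μ i = r := by
  simp [weights]

theorem sum_proj : ∑ μ ∈ weights n r, D.proj (fun i => μ i) = 1 := by
  apply D.eq_of_eigen
  intro μ hμ y hy
  rw [one_mul, Finset.sum_mul, Finset.sum_eq_single μ]
  · rw [D.proj_mul_of_eigen hμ hy, if_pos rfl]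
  · intro ν _ hne
    rw [D.proj_mul_of_eigen hμ hy, if_neg]
    intro h
    exact hne (funext fun i => by exact_mod_cast (congrFun h i).symm)
  · intro h; exact absurd (mem_weights.2 hμ) h

theorem eq_sum_mul_proj (z : R) : z = ∑ μ ∈ weights n r, z * D.proj (fun i => μ i) := by
  rw [← Finset.mul_sum, D.sum_proj, mul_one]

/-- `z` is homogeneous of weight `ω` for the adjoint action of the Cartan elements. -/
def HasWeight (ω : Fin n → ℤ) (z : R) : Prop :=
  ∀ i, D.X i i * z = z * D.X i i + (ω i : ℚ) • z

variable {D}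

theorem HasWeight.one : D.HasWeight 0 1 := fun i => by simp

theorem HasWeight.zero (ω : Fin n → ℤ) : D.HasWeight ω 0 := fun i => by simp

theorem HasWeight.mul {ω ω' : Fin n → ℤ} {z z' : R} (h : D.HasWeight ω z)
    (h' : D.HasWeight ω' z') : D.HasWeight (ω + ω') (z * z') := fun i => by
  rw [← mul_assoc, h i, add_mul, mul_assoc, h' i]
  simp only [Pi.add_apply, mul_add, mul_assoc, mul_smul_comm, smul_mul_assoc]
  push_cast
  module

theorem HasWeight.pow {ω : Fin n → ℤ} {z : R} (h : D.HasWeight ω z) (k : ℕ) :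
    D.HasWeight (k • ω) (z ^ k) := by
  induction k with
  | zero => simpa using HasWeight.one
  | succ k ih => rw [pow_succ, succ_nsmul]; exact ih.mul h

theorem HasWeight.smul {ω : Fin n → ℤ} {z : R} (h : D.HasWeight ω z) (q : ℚ) :
    D.HasWeight ω (q • z) := fun i => by
  rw [mul_smul_comm, h i, smul_mul_assoc]; module

theorem HasWeight.dpz {ω : Fin n → ℤ} {z : R} (h : D.HasWeight ω z) (k : ℕ) :
    D.HasWeight (k • ω) (dpz z k) := by
  rw [dpz_natCast]; exact (h.pow k).smul _

/-- `z * D.proj μ` is a left weight vector of weight `μ + ω`, so the projections detect it exactly.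
-/
theorem HasWeight.proj_mul {ω : Fin n → ℤ} {z : R} (h : D.HasWeight ω z) (μ : Fin n → ℤ) :
    D.proj (μ + ω) * z = z * D.proj μ := by
  have key : ∀ μ ν : Fin n → ℤ, D.proj ν * (z * D.proj μ) =
      if ν = μ + ω then z * D.proj μ else 0 := by
    intro μ ν
    have heig : D.Eigen (μ + ω) (z * D.proj μ) := fun i => by
      rw [← mul_assoc, h i, add_mul, mul_assoc, D.cartan_mul_proj, mul_smul_comm, smul_mul_assoc,
        ← add_smul]
      simp
    have hz : ∀ ν, ν ≠ μ + ω → D.proj ν * (z * D.proj μ) = 0 := by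
      intro ν hν
      obtain ⟨i, hi⟩ := Function.ne_iff.1 hν
      have h1 : D.proj ν * D.X i i * (z * D.proj μ) = D.proj ν * (D.X i i * (z * D.proj μ)) :=
        mul_assoc _ _ _
      rw [D.proj_mul_cartan, heig i, smul_mul_assoc, mul_smul_comm] at h1
      by_contra hne
      exact hi (by exact_mod_cast smul_left_injective ℚ hne h1)
    split_ifs with hν
    · subst hν
      have h1 := congrArg (· * (z * D.proj μ)) D.sum_proj
      simp only [Finset.sum_mul, one_mul] at h1
      -- In the expansion by `sum_proj` only the weight `μ + ω` can contribute. If that is not a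
      -- composition of `r`, nothing does, and `z * D.proj μ` is zero.
      by_cases hp : ∃ b : Fin n → ℕ, ∑ i, b i = r ∧ μ + ω = fun i => (b i : ℤ)
      · obtain ⟨b, hb, hbe⟩ := hp
        rw [Finset.sum_eq_single b, ← hbe] at h1
        · exact h1
        · intro c _ hc
          apply hz
          intro hce
          rw [hbe] at hce
          exact hc (funext fun i => by exact_mod_cast congrFun hce i)
        · intro h; exact absurd (mem_weights.2 hb) h
      · rw [Finset.sum_eq_zero] at h1
        · rw [← h1, mul_zero]
        · intro c hc
          apply hz
          intro hce
          exact hp ⟨c, mem_weights.1 hc, hce.symm⟩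
    · exact hz ν hν
  rw [D.eq_sum_mul_proj (D.proj (μ + ω) * z)]
  simp only [mul_assoc, key]
  by_cases hμ : D.proj μ = 0
  · rw [hμ, mul_zero]
    apply Finset.sum_eq_zero
    intro b _
    split_ifs with h
    · rw [← add_right_cancel h, hμ, mul_zero]
    · rfl
  · obtain ⟨b, hb, rfl⟩ := D.exists_of_proj_ne_zero hμ
    rw [Finset.sum_eq_single b]
    · simp
    · intro c _ hc
      rw [if_neg]
      intro h
      exact hc (funext fun i => by exact_mod_cast (congrFun (add_right_cancel h) i).symm)
    · intro h; exact absurd (mem_weights.2 hb) h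

theorem HasWeight.mul_proj {ω : Fin n → ℤ} {z : R} (h : D.HasWeight ω z) (μ : Fin n → ℤ) :
    D.proj μ * z = z * D.proj (μ - ω) := by
  rw [← h.proj_mul, sub_add_cancel]

variable (D)

/-- The weight `ε_i - ε_j`. -/
def root (i j : Fin n) : Fin n → ℤ := Pi.single i 1 - Pi.single j 1

theorem hasWeight_X (i j : Fin n) : D.HasWeight (root i j) (D.X i j) := fun k => by
  rw [D.XX]
  congr 1
  by_cases h1 : k = i <;> by_cases h2 : k = j <;> by_cases h3 : i = j <;>
    simp [h3, root, h1, h2, eq_comm]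

theorem hasWeight_Y (i j : Fin n) : D.HasWeight (root i j) (D.Y i j) := fun k => by
  rw [D.XY]
  congr 1
  by_cases h1 : k = i <;> by_cases h2 : k = j <;> by_cases h3 : i = j <;>
    simp [h3, root, h1, h2, eq_comm]

/-- Where `X i i` acts by 0, the product in `cartan` acts by $(-1)^r r!\ne0$, so the relation forces
`Y i i` to vanish there. -/
theorem Y_cartan_mul_proj {i : Fin n} {μ : Fin n → ℤ} (h : μ i = 0) :
    D.Y i i * D.proj μ = 0 := by
  have key : ∀ k : ℕ, ((List.range k).map fun t => D.X i i - ((t + 1 : ℕ) : R)).prod * D.proj μ =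
      ((-1 : ℚ) ^ k * k.factorial) • D.proj μ := by
    intro k
    induction k with
    | zero => simp
    | succ k ih =>
      rw [List.range_succ, List.map_append, List.prod_append, List.map_singleton,
        List.prod_singleton, mul_assoc, sub_mul, D.cartan_mul_proj, natCast_mul_eq_smul, h,
        ← sub_smul, mul_smul_comm, ih, smul_smul, Nat.factorial_succ]
      congr 1
      push_cast
      ring
  have h1 := congrArg (D.Y i i * ·) (key r)
  simp only [← mul_assoc, D.cartan i, zero_mul, mul_smul_comm] at h1
  exact (smul_eq_zero.1 h1.symm).resolve_left
    (mul_ne_zero (pow_ne_zero _ (by norm_num)) (by exact_mod_cast Nat.factorial_ne_zero r))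

end SchurData

/-! ### Words in root vectors and the degree filtration. -/

/-- The positions of the root vectors: `(false, i, j)` for `x_{i,j}`, `(true, i, j)` for
`x̄_{i,j}`. -/
abbrev Pos (n : ℕ) : Type := Bool × Fin n × Fin n

/-- A root vector together with an exponent. -/
abbrev Letter (n : ℕ) : Type := Pos n × ℕ

/-- The sum of the exponents of a word. -/
def degree {n : ℕ} (w : List (Letter n)) : ℕ := (w.map Prod.snd).sum

@[simp] theorem degree_nil {n : ℕ} : degree ([] : List (Letter n)) = 0 := rfl

@[simp] theorem degree_cons {n : ℕ} (l : Letter n) (w : List (Letter n)) :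
    degree (l :: w) = l.2 + degree w := by simp [degree]

@[simp] theorem degree_append {n : ℕ} (w w' : List (Letter n)) :
    degree (w ++ w') = degree w + degree w' := by simp [degree]

theorem degree_perm {n : ℕ} {w w' : List (Letter n)} (h : w.Perm w') : degree w = degree w' :=
  (h.map _).sum_eq

namespace SchurData

variable {n r : ℕ} {R : Type*} [Ring R] [Algebra ℚ R] (D : SchurData n r R)

/-- The value of a letter: `x_{i,j}^{(a)}` for `i ≠ j` and `x̄_{i,j}^a` for `a ≤ 1`; letters of
any other shape have value zero, unless the exponent is zero. -/
def val : Letter n → R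
  | ((false, i, j), a) => if i = j then (if a = 0 then 1 else 0) else dpz (D.X i j) a
  | ((true, i, j), a) => if a ≤ 1 then D.Y i j ^ a else 0

/-- The value of a word. -/
def ev (w : List (Letter n)) : R := (w.map D.val).prod

@[simp] theorem ev_nil : D.ev [] = 1 := rfl

@[simp] theorem ev_cons (l : Letter n) (w : List (Letter n)) :
    D.ev (l :: w) = D.val l * D.ev w := by simp [ev]

@[simp] theorem ev_append (w w' : List (Letter n)) : D.ev (w ++ w') = D.ev w * D.ev w' := by
  simp [ev]

@[simp] theorem val_zero (p : Pos n) : D.val (p, 0) = 1 := by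
  obtain ⟨_ | _, i, j⟩ := p <;> simp [val]

theorem val_even {i j : Fin n} (h : i ≠ j) (a : ℕ) :
    D.val ((false, i, j), a) = dpz (D.X i j) a := by simp [val, h]

theorem val_even_self (i : Fin n) {a : ℕ} (h : a ≠ 0) : D.val ((false, i, i), a) = 0 := by
  simp [val, h]

theorem val_odd_one (i j : Fin n) : D.val ((true, i, j), 1) = D.Y i j := by simp [val]

theorem val_odd_of_lt (i j : Fin n) {a : ℕ} (h : 1 < a) : D.val ((true, i, j), a) = 0 := by
  simp [val, h]

/-- The weight of a word. -/
def wordWeight (w : List (Letter n)) : Fin n → ℤ :=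
  (w.map fun l => l.2 • root l.1.2.1 l.1.2.2).sum

theorem hasWeight_val (l : Letter n) : D.HasWeight (l.2 • root l.1.2.1 l.1.2.2) (D.val l) := by
  obtain ⟨⟨_ | _, i, j⟩, a⟩ := l
  · by_cases h : i = j
    · subst h
      rcases Nat.eq_zero_or_pos a with rfl | ha
      · simpa using HasWeight.one
      · rw [val_even_self _ _ ha.ne']; exact HasWeight.zero _
    · rw [val_even _ h]; exact (D.hasWeight_X i j).dpz a
  · rcases le_or_gt a 1 with ha | ha
    · simpa [val, ha] using (D.hasWeight_Y i j).pow a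
    · rw [val_odd_of_lt _ _ _ ha]; exact HasWeight.zero _

theorem hasWeight_ev (w : List (Letter n)) : D.HasWeight (wordWeight w) (D.ev w) := by
  induction w with
  | nil => exact HasWeight.one
  | cons l w ih =>
    rw [ev_cons, wordWeight, List.map_cons, List.sum_cons]
    exact (D.hasWeight_val l).mul ih

/-- The `ℤ`-span of the words of degree less than `d`, multiplied by weight projections. -/
def filt (d : ℕ) : Submodule ℤ R :=
  Submodule.span ℤ {z | ∃ w μ, degree w < d ∧ z = D.ev w * D.proj μ}

variable {D}

theorem filt_mono {d e : ℕ} (h : d ≤ e) : D.filt d ≤ D.filt e :=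
  Submodule.span_mono fun _ ⟨w, μ, hw, hz⟩ => ⟨w, μ, hw.trans_le h, hz⟩

theorem ev_mul_proj_mem {w : List (Letter n)} {d : ℕ} (h : degree w < d) (μ : Fin n → ℤ) :
    D.ev w * D.proj μ ∈ D.filt d := Submodule.subset_span ⟨w, μ, h, rfl⟩

/-- The projections sum to 1, so membership can be tested on one weight at a time, where Cartan
elements act by integers. -/
theorem mem_filt_of_mul_proj {z : R} {d : ℕ} (h : ∀ μ, z * D.proj μ ∈ D.filt d) :
    z ∈ D.filt d := by
  rw [D.eq_sum_mul_proj z]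
  exact Submodule.sum_mem _ fun μ _ => h _

theorem ev_mem_filt {w : List (Letter n)} {d : ℕ} (h : degree w < d) : D.ev w ∈ D.filt d :=
  mem_filt_of_mul_proj fun μ => ev_mul_proj_mem h μ

theorem val_mem_filt {l : Letter n} {d : ℕ} (h : l.2 < d) : D.val l ∈ D.filt d := by
  simpa using ev_mem_filt (D := D) (w := [l]) (d := d) (by simpa)

theorem proj_mul_mem_filt {z : R} {d : ℕ} (h : z ∈ D.filt d) (μ : Fin n → ℤ) :
    D.proj μ * z ∈ D.filt d := by
  refine Submodule.span_induction (p := fun z _ => D.proj μ * z ∈ D.filt d) ?_ (by simp)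
    (fun _ _ _ _ h1 h2 => by rw [mul_add]; exact add_mem h1 h2)
    (fun c _ _ h1 => by rw [mul_smul_comm]; exact Submodule.smul_mem _ c h1) h
  rintro _ ⟨w, ν, hw, rfl⟩
  rw [← mul_assoc, (D.hasWeight_ev w).mul_proj, mul_assoc, proj_mul_proj]
  split_ifs
  · exact ev_mul_proj_mem hw _
  · simp

theorem ev_mul_mem_filt {z : R} {d : ℕ} (h : z ∈ D.filt d) (w : List (Letter n)) :
    D.ev w * z ∈ D.filt (degree w + d) := by
  refine Submodule.span_induction (p := fun z _ => D.ev w * z ∈ D.filt (degree w + d)) ?_ (by simp)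
    (fun _ _ _ _ h1 h2 => by rw [mul_add]; exact add_mem h1 h2)
    (fun c _ _ h1 => by rw [mul_smul_comm]; exact Submodule.smul_mem _ c h1) h
  rintro _ ⟨w', ν, hw, rfl⟩
  rw [← mul_assoc, ← ev_append]
  exact ev_mul_proj_mem (by rw [degree_append]; lia) _

/-- Degrees in `filt` are strictly bounded: at most `d` on the left plus less than `e` on the right
stays below `d + e`. The inner projection is first absorbed into `z`. -/
theorem mul_mem_filt {y z : R} {d e : ℕ} (hy : y ∈ D.filt (d + 1)) (hz : z ∈ D.filt e) :
    y * z ∈ D.filt (d + e) := by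
  refine Submodule.span_induction (p := fun y _ => y * z ∈ D.filt (d + e)) ?_ (by simp)
    (fun _ _ _ _ h1 h2 => by rw [add_mul]; exact add_mem h1 h2)
    (fun c _ _ h1 => by rw [smul_mul_assoc]; exact Submodule.smul_mem _ c h1) hy
  rintro _ ⟨w, ν, hw, rfl⟩
  rw [mul_assoc]
  exact filt_mono (by lia) (ev_mul_mem_filt (proj_mul_mem_filt hz ν) w)

theorem mul_mem_filt' {y z : R} {d e : ℕ} (hy : y ∈ D.filt d) (hz : z ∈ D.filt (e + 1)) :
    y * z ∈ D.filt (d + e) := by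
  cases d with
  | zero =>
    have : y = 0 := by simpa [filt] using hy
    simp [this]
  | succ d => exact filt_mono (by lia) (mul_mem_filt hy hz)

variable (D)

theorem dpz_mem_filt {i j : Fin n} (h : i ≠ j) {k : ℤ} {d : ℕ} (hk : k < d) :
    dpz (D.X i j) k ∈ D.filt d := by
  rcases lt_or_ge k 0 with h0 | h0
  · rw [dpz_of_neg _ h0]; exact zero_mem _
  · lift k to ℕ using h0
    rw [← D.val_even h]
    exact val_mem_filt (by simpa using hk)

/-- Cartan elements have degree 0, being integral combinations of projections; this is why no letter
stands for them. -/
theorem cartan_mem_filt (i : Fin n) : D.X i i ∈ D.filt 1 := by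
  apply mem_filt_of_mul_proj
  intro μ
  rw [cartan_mul_proj, Int.cast_smul_eq_zsmul]
  exact Submodule.smul_mem _ _ (by simpa using ev_mul_proj_mem (D := D) (w := []) (by simp) μ)

theorem X_mem_filt (i j : Fin n) : D.X i j ∈ D.filt 2 := by
  by_cases h : i = j
  · subst h; exact filt_mono (by lia) (D.cartan_mem_filt i)
  · simpa using D.dpz_mem_filt h (k := 1) (d := 2) (by simp)

theorem Y_mem_filt (i j : Fin n) : D.Y i j ∈ D.filt 2 := by
  rw [← val_odd_one]; exact val_mem_filt (by simp)

theorem ite_mem_filt {P : Prop} [Decidable P] {z : R} {d : ℕ} (h : z ∈ D.filt d) :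
    (if P then z else 0) ∈ D.filt d := by
  split_ifs
  · exact h
  · exact zero_mem _

/-! ### Letters commute up to sign modulo lower degree. -/

/-- The commutator of divided powers of `x_{i,j}` and `x_{j,l}` for distinct `i`, `j`, `l`. -/
theorem commutator_mem_of_heisenberg {i j l : Fin n} (hij : i ≠ j) (hjl : j ≠ l) (hil : i ≠ l)
    (a b : ℕ) : dpz (D.X i j) a * dpz (D.X j l) b - dpz (D.X j l) b * dpz (D.X i j) a ∈
      D.filt (a + b) := by
  rw [dpz_mul_dpz_of_heisenberg (y := D.X i j) (z := D.X j l) (c := D.X i l)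
    (by rw [D.XX]; simp [hil])
    (by rw [Commute, SemiconjBy, D.XX]; simp [hij.symm, hil])
    (by rw [Commute, SemiconjBy, D.XX]; simp [hil.symm, hjl]), Finset.sum_range_succ']
  -- The term `t = 0` is the reversed product and cancels; each later term trades one exponent on
  -- both sides for one on `X i l`.
  simp only [Nat.cast_zero, sub_zero, dpz_zero, mul_one, add_sub_cancel_right]
  apply Submodule.sum_mem
  intro t ht
  have ht : t < a := Finset.mem_range.1 ht
  rcases lt_or_ge (b : ℤ) (t + 1 : ℕ) with h | h
  · rw [dpz_of_neg _ (by lia)]; simp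
  · have h1 := D.dpz_mem_filt hjl (k := (b : ℤ) - (t + 1 : ℕ)) (d := b - t - 1 + 1) (by lia)
    have h2 := D.dpz_mem_filt hil (k := (t + 1 : ℕ)) (d := t + 1 + 1) (by lia)
    have h3 := D.dpz_mem_filt hij (k := (a : ℤ) - (t + 1 : ℕ)) (d := a - t - 1 + 1) (by lia)
    exact filt_mono (by lia) (mul_mem_filt' (mul_mem_filt' h1 h2) h3)

/-- The commutator of divided powers of two opposite root vectors. -/
theorem commutator_mem_of_sl2 {i j : Fin n} (hij : i ≠ j) (a b : ℕ) :
    dpz (D.X i j) a * dpz (D.X j i) b - dpz (D.X j i) b * dpz (D.X i j) a ∈ D.filt (a + b) := by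
  -- A projection on the right provides the weight vector that makes the coefficients of the `sl₂`
  -- formula integers.
  apply mem_filt_of_mul_proj
  intro μ
  rw [sub_mul, dpz_mul_dpz_of_sl2 (e := D.X i j) (f := D.X j i) (H := D.X i i - D.X j j)
    (wt := μ i - μ j) (by rw [D.XX]; simp)
    (by rw [sub_mul, mul_sub, D.XX i i, D.XX j j]; simp [hij, hij.symm]; module)
    (by rw [sub_mul, mul_sub, D.XX i i, D.XX j j]; simp [hij, hij.symm]; module)
    (by rw [sub_mul, cartan_mul_proj, cartan_mul_proj, ← sub_smul]; push_cast; rfl),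
    Finset.sum_range_succ']
  simp only [Nat.cast_zero, sub_zero, Ring.choose_zero_right, one_smul, add_sub_cancel_right]
  apply Submodule.sum_mem
  intro t ht
  have ht : t < a := Finset.mem_range.1 ht
  apply Submodule.smul_mem
  rcases lt_or_ge (b : ℤ) (t + 1 : ℕ) with h | h
  · rw [dpz_of_neg _ (by lia)]; simp
  · have h1 := D.dpz_mem_filt hij.symm (k := (b : ℤ) - (t + 1 : ℕ)) (d := b - t - 1 + 1) (by lia)
    have h3 := D.dpz_mem_filt hij (k := (a : ℤ) - (t + 1 : ℕ)) (d := a - t - 1 + 1) (by lia)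
    have h4 : D.proj μ ∈ D.filt 1 := by
      simpa using ev_mul_proj_mem (D := D) (w := []) (by simp) μ
    exact filt_mono (by lia) (mul_mem_filt' (mul_mem_filt' h1 h3) h4)

theorem commutator_mem_of_even {i j k l : Fin n} (hij : i ≠ j) (hkl : k ≠ l) (a b : ℕ) :
    dpz (D.X i j) a * dpz (D.X k l) b - dpz (D.X k l) b * dpz (D.X i j) a ∈ D.filt (a + b) := by
  by_cases hjk : j = k
  · subst hjk
    by_cases hil : i = l
    · subst hil; exact D.commutator_mem_of_sl2 hij a b
    · exact D.commutator_mem_of_heisenberg hij hkl hil a b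
  · by_cases hil : i = l
    · subst hil
      rw [← neg_sub, add_comm]
      exact neg_mem (D.commutator_mem_of_heisenberg hkl hij (Ne.symm hjk) b a)
    · have hc : Commute (D.X i j) (D.X k l) := by
        rw [Commute, SemiconjBy, D.XX]; simp [hjk, hil]
      have : Commute (dpz (D.X i j) a) (dpz (D.X k l) b) :=
        commute_dpz (commute_dpz hc.symm a).symm b
      rw [this.eq, sub_self]
      exact zero_mem _

theorem commutator_mem_of_even_odd {i j : Fin n} (hij : i ≠ j) (k l : Fin n) (a : ℕ) :
    dpz (D.X i j) a * D.Y k l - D.Y k l * dpz (D.X i j) a ∈ D.filt (a + 1) := by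
  -- The second commutator survives only for opposite positions, where it equals `-2 • Y i j`; half
  -- of it is `v₂`.
  rw [dpz_mul_of_ad (v₁ := (if j = k then D.Y i l else 0) - (if i = l then D.Y k j else 0))
    (v₂ := -(if j = k ∧ i = l then D.Y i j else 0)) (D.XY i j k l) ?_ ?_]
  · rw [add_assoc, add_sub_cancel_left]
    have h1 : (if j = k then D.Y i l else 0) - (if i = l then D.Y k j else 0) ∈ D.filt (1 + 1) :=
      sub_mem (D.ite_mem_filt (D.Y_mem_filt _ _)) (D.ite_mem_filt (D.Y_mem_filt _ _))
    have h2 : -(if j = k ∧ i = l then D.Y i j else 0) ∈ D.filt (1 + 1) :=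
      neg_mem (D.ite_mem_filt (D.Y_mem_filt _ _))
    refine add_mem ?_ ?_
    · exact filt_mono (by lia) (mul_mem_filt h1 (D.dpz_mem_filt hij (d := a) (by lia)))
    · exact filt_mono (by lia) (mul_mem_filt h2 (D.dpz_mem_filt hij (d := a) (by lia)))
  · by_cases hjk : j = k <;> by_cases hil : i = l
    · subst hjk hil
      simp only [if_true, and_self, mul_sub, sub_mul, D.XY i j i i, D.XY i j j j]
      simp [hij, hij.symm]
      module
    · subst hjk; simp [hil, D.XY i j i l, hij.symm]
    · subst hil; simp [hjk, D.XY i j k j, hij]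
    · simp [hjk, hil]
  · split_ifs
    · rw [mul_neg, D.XY i j i j]; simp [hij, hij.symm]
    · simp

/-- Any two letters commute up to a sign and words of lower degree. -/
theorem exists_swap (l l' : Letter n) :
    ∃ ε : ℤˣ, D.val l * D.val l' - ε • (D.val l' * D.val l) ∈ D.filt (l.2 + l'.2) := by
  obtain ⟨p, a⟩ := l
  obtain ⟨q, b⟩ := l'
  have triv : ∀ {u v : R} {d : ℕ}, Commute u v → ∃ ε : ℤˣ, u * v - ε • (v * u) ∈ D.filt d :=
    fun h => ⟨1, by rw [one_smul, h.eq, sub_self]; exact zero_mem _⟩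
  have symm : ∀ u v : Letter n,
      (∃ ε : ℤˣ, D.val u * D.val v - ε • (D.val v * D.val u) ∈ D.filt (u.2 + v.2)) →
      ∃ ε : ℤˣ, D.val v * D.val u - ε • (D.val u * D.val v) ∈ D.filt (v.2 + u.2) := by
    rintro u v ⟨ε, h⟩
    refine ⟨ε, ?_⟩
    rw [add_comm]
    have := neg_mem (Submodule.smul_mem _ (ε : ℤ) h)
    rw [← Units.smul_def, smul_sub, smul_smul, Int.units_mul_self, one_smul, neg_sub] at this
    exact this
  have evenodd : ∀ i j k l : Fin n, ∀ a b : ℕ, ∃ ε : ℤˣ,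
      D.val ((false, i, j), a) * D.val ((true, k, l), b) -
        ε • (D.val ((true, k, l), b) * D.val ((false, i, j), a)) ∈ D.filt (a + b) := by
    intro i j k l a b
    rcases Nat.eq_zero_or_pos a with rfl | ha
    · exact triv (by simp)
    by_cases hij : i = j
    · subst hij; exact triv (by simp [val_even_self _ _ ha.ne'])
    rcases lt_trichotomy b 1 with hb | rfl | hb
    · obtain rfl : b = 0 := by lia
      exact triv (by simp)
    · refine ⟨1, ?_⟩
      rw [one_smul, val_even _ hij, val_odd_one]
      exact D.commutator_mem_of_even_odd hij k l a
    · exact triv (by simp [val_odd_of_lt _ _ _ hb])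
  obtain ⟨_ | _, i, j⟩ := p <;> obtain ⟨_ | _, k, l⟩ := q
  · rcases Nat.eq_zero_or_pos a with rfl | ha
    · exact triv (by simp)
    rcases Nat.eq_zero_or_pos b with rfl | hb
    · exact triv (by simp)
    by_cases hij : i = j
    · subst hij; exact triv (by simp [val_even_self _ _ ha.ne'])
    by_cases hkl : k = l
    · subst hkl; exact triv (by simp [val_even_self _ _ hb.ne'])
    refine ⟨1, ?_⟩
    rw [one_smul, val_even _ hij, val_even _ hkl]
    exact D.commutator_mem_of_even hij hkl a b
  · exact evenodd i j k l a b
  · exact symm _ _ (evenodd k l i j b a)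
  · rcases lt_trichotomy a 1 with ha | rfl | ha
    · obtain rfl : a = 0 := by lia
      exact triv (by simp)
    · rcases lt_trichotomy b 1 with hb | rfl | hb
      · obtain rfl : b = 0 := by lia
        exact triv (by simp)
      -- Two odd letters anticommute up to single even root vectors and Cartan elements.
      · refine ⟨-1, ?_⟩
        rw [val_odd_one, val_odd_one, D.YY]
        simp only [Units.neg_smul, one_smul, sub_neg_eq_add, neg_add_cancel_comm]
        exact add_mem (D.ite_mem_filt (D.X_mem_filt _ _)) (D.ite_mem_filt (D.X_mem_filt _ _))
      · exact triv (by simp [val_odd_of_lt _ _ _ hb])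
    · exact triv (by simp [val_odd_of_lt _ _ _ ha])

/-- Rearranging a word changes its value by a sign and words of lower degree. -/
theorem exists_of_perm {w w' : List (Letter n)} (h : w.Perm w') :
    ∃ ε : ℤˣ, D.ev w - ε • D.ev w' ∈ D.filt (degree w) := by
  induction h with
  | nil => exact ⟨1, by simp⟩
  | cons l _ ih =>
    obtain ⟨ε, h⟩ := ih
    refine ⟨ε, ?_⟩
    have := ev_mul_mem_filt h [l]
    rw [mul_sub, Units.smul_def, mul_smul_comm, ← Units.smul_def] at this
    simpa only [ev_cons, ev_nil, mul_one, degree_cons, degree_nil, add_zero] using this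
  | swap l l' w =>
    obtain ⟨ε, h⟩ := D.exists_swap l' l
    refine ⟨ε, ?_⟩
    have := mul_mem_filt' h (ev_mem_filt (D := D) (w := w) (Nat.lt_succ_self _))
    rw [sub_mul, Units.smul_def, smul_mul_assoc, ← Units.smul_def] at this
    simpa only [ev_cons, degree_cons, mul_assoc, add_assoc] using this
  | trans h₁ _ ih₁ ih₂ =>
    obtain ⟨ε₁, h1⟩ := ih₁
    obtain ⟨ε₂, h2⟩ := ih₂
    refine ⟨ε₁ * ε₂, ?_⟩
    rw [← degree_perm h₁] at h2
    have := add_mem h1 (Submodule.smul_mem _ (ε₁ : ℤ) h2)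
    rwa [← Units.smul_def, smul_sub, smul_smul, sub_add_sub_cancel] at this

/-- Two letters with the same root vector merge, up to words of lower degree. -/
theorem exists_merge (p : Pos n) (a b : ℕ) :
    ∃ k : ℤ, D.val (p, a) * D.val (p, b) - k • D.val (p, a + b) ∈ D.filt (a + b) := by
  rcases Nat.eq_zero_or_pos a with rfl | ha
  · exact ⟨1, by simp⟩
  rcases Nat.eq_zero_or_pos b with rfl | hb
  · exact ⟨1, by simp⟩
  obtain ⟨_ | _, i, j⟩ := p
  · by_cases hij : i = j
    · subst hij; exact ⟨0, by simp [val_even_self _ _ ha.ne']⟩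
    · refine ⟨(a + b).choose a, ?_⟩
      rw [val_even _ hij, val_even _ hij, val_even _ hij, dpz_mul_dpz, sub_self]
      exact zero_mem _
  -- An odd root vector squares to 0 or to a Cartan element, so the degree drops.
  · refine ⟨0, ?_⟩
    rw [zero_smul, sub_zero]
    rcases lt_trichotomy a 1 with ha' | rfl | ha'
    · lia
    · rcases lt_trichotomy b 1 with hb' | rfl | hb'
      · lia
      · rw [val_odd_one, Y_mul_self]
        exact D.ite_mem_filt (D.X_mem_filt _ _)
      · simp [val_odd_of_lt _ _ _ hb']
    · simp [val_odd_of_lt _ _ _ ha']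

end SchurData

/-! ### Orderings of the positions and the combinatorics of `chi`. -/

section Positions

variable {n : ℕ}

/-- The positions below the diagonal, in the order of `fMinus`. -/
def lowerPos (n : ℕ) : List (Pos n) :=
  (List.finRange n).flatMap fun j => ((List.finRange n).filter fun l => j < l).reverse.flatMap
    fun l => [(false, l, j), (true, l, j)]

/-- The odd positions on the diagonal. -/
def diagPos (n : ℕ) : List (Pos n) := (List.finRange n).map fun i => (true, i, i)

/-- The positions above the diagonal, in the order of `ePlus`. -/
def upperPos (n : ℕ) : List (Pos n) :=
  (List.finRange n).reverse.flatMap fun j => ((List.finRange n).filter fun l => j < l).flatMap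
    fun l => [(false, j, l), (true, j, l)]

/-- All positions of root vectors, in the order of `uLift`. -/
def allPos (n : ℕ) : List (Pos n) := lowerPos n ++ (diagPos n ++ upperPos n)

theorem mem_lowerPos {p : Pos n} : p ∈ lowerPos n ↔ p.2.2 < p.2.1 := by
  obtain ⟨_ | _, i, j⟩ := p <;> simp [lowerPos]

theorem mem_diagPos {p : Pos n} : p ∈ diagPos n ↔ p.1 = true ∧ p.2.1 = p.2.2 := by
  obtain ⟨_ | _, i, j⟩ := p <;> simp [diagPos]

theorem mem_upperPos {p : Pos n} : p ∈ upperPos n ↔ p.2.1 < p.2.2 := by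
  obtain ⟨_ | _, i, j⟩ := p <;> simp [upperPos]

theorem mem_allPos {p : Pos n} : p ∈ allPos n ↔ p.1 = true ∨ p.2.1 ≠ p.2.2 := by
  rw [allPos, List.mem_append, List.mem_append, mem_lowerPos, mem_diagPos, mem_upperPos]
  grind

theorem nodup_lowerPos : (lowerPos n).Nodup := by
  rw [lowerPos, List.nodup_flatMap]
  refine ⟨fun j _ => ?_, (List.nodup_finRange n).imp fun {a b} hab => ?_⟩
  · rw [List.nodup_flatMap]
    refine ⟨fun l _ => by simp, List.Pairwise.imp (fun {a b} hab => ?_)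
      (List.nodup_reverse.2 ((List.nodup_finRange n).filter _))⟩
    intro p hp hp'
    simp at hp hp'
    grind
  · intro p hp hp'
    simp at hp hp'
    grind

theorem nodup_upperPos : (upperPos n).Nodup := by
  rw [upperPos, List.nodup_flatMap]
  refine ⟨fun j _ => ?_, (List.nodup_reverse.2 (List.nodup_finRange n)).imp fun {a b} hab => ?_⟩
  · rw [List.nodup_flatMap]
    refine ⟨fun l _ => by simp, List.Pairwise.imp (fun {a b} hab => ?_)
      ((List.nodup_finRange n).filter _)⟩
    intro p hp hp'
    simp at hp hp'
    grind
  · intro p hp hp'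
    simp at hp hp'
    grind

theorem nodup_diagPos : (diagPos n).Nodup :=
  (List.nodup_finRange n).map fun _ _ h => by simpa using h

theorem nodup_allPos : (allPos n).Nodup := by
  rw [allPos, List.nodup_append', List.nodup_append']
  refine ⟨nodup_lowerPos, ⟨nodup_diagPos, nodup_upperPos, ?_⟩, ?_⟩
  · intro p hp hp'
    rw [mem_diagPos] at hp
    rw [mem_upperPos] at hp'
    exact hp'.ne hp.2
  · intro p hp hp'
    rw [mem_lowerPos] at hp
    rw [List.mem_append, mem_diagPos, mem_upperPos] at hp'
    grind

theorem sum_map_of_nodup {P : List (Pos n)} (hP : P.Nodup) {Q : Pos n → Prop} [DecidablePred Q]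
    (hQ : ∀ p, p ∈ P ↔ Q p) (g : Pos n → ℤ) : (P.map g).sum = ∑ p, if Q p then g p else 0 := by
  rw [← List.sum_toFinset g hP, ← Finset.sum_filter]
  congr 1
  ext p
  simp [hQ]

/-- The word with the given list of positions and exponents given by `C`. -/
def word (P : List (Pos n)) (C : Pos n → ℕ) : List (Letter n) := P.map fun p => (p, C p)

/-- The exponents given by a matrix. -/
def expo (A : SMat n) : Pos n → ℕ
  | (false, i, j) => A.1 i j
  | (true, i, j) => A.2 i j

theorem word_perm {P P' : List (Pos n)} (h : P.Perm P') (C : Pos n → ℕ) :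
    (word P C).Perm (word P' C) := h.map _

theorem wordWeight_apply (P : List (Pos n)) (C : Pos n → ℕ) (i : Fin n) :
    SchurData.wordWeight (word P C) i =
      (P.map fun p => (C p : ℤ) * SchurData.root p.2.1 p.2.2 i).sum := by
  induction P with
  | nil => rfl
  | cons p P ih =>
    have : SchurData.wordWeight (word (p :: P) C) =
      C p • SchurData.root p.2.1 p.2.2 + SchurData.wordWeight (word P C) := rfl
    rw [this, Pi.add_apply, ih]
    simp

/-- The off-diagonal positions in row `i`. -/
def rowPos (i : Fin n) : List (Pos n) :=
  (allPos n).filter fun p => p.2.1 = i ∧ p.2.2 ≠ i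

theorem mem_rowPos {i : Fin n} {p : Pos n} : p ∈ rowPos i ↔ p.2.1 = i ∧ p.2.2 ≠ i := by
  rw [rowPos, List.mem_filter, mem_allPos]
  simp only [decide_eq_true_eq]
  grind

theorem nodup_rowPos (i : Fin n) : (rowPos i).Nodup := nodup_allPos.filter _

/-- The origin of `chi`. At `i`, row `i` contributes $\sum_{j\ne i}c_{ij}$, while the lower part
contributes $\sum_{j<i}c_{ij}-\sum_{j>i}c_{ji}$. -/
theorem wordWeight_sub_wordWeight (A : SMat n) (i : Fin n) :
    SchurData.wordWeight (word (rowPos i) (expo A)) i -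
      SchurData.wordWeight (word (lowerPos n) (expo A)) i + entry A i i = chi A i := by
  have h : ∀ g : Fin n → Fin n → ℤ, (∑ a, ∑ b, ((if a = i ∧ i < b then g a b else 0) +
      if b = i ∧ i < a then g a b else 0)) = ∑ j ∈ Finset.Ioi i, (g i j + g j i) := by
    intro g
    have h1 : ∀ a, (∑ b, if a = i ∧ i < b then g a b else 0) =
        if a = i then ∑ b, if i < b then g i b else 0 else 0 := by
      intro a
      by_cases ha : a = i
      · subst ha; simp
      · simp [ha]
    have h2 : ∀ a, (∑ b, if b = i ∧ i < a then g a b else 0) = if i < a then g a i else 0 := by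
      intro a
      simp [ite_and]
    simp only [Finset.sum_add_distrib, h1, h2]
    rw [Finset.sum_ite_eq' Finset.univ i, if_pos (Finset.mem_univ i), ← Finset.sum_filter,
      ← Finset.sum_filter]
    have : Finset.univ.filter (fun b => i < b) = Finset.Ioi i := by ext; simp
    rw [this]
  rw [wordWeight_apply, wordWeight_apply,
    sum_map_of_nodup (nodup_rowPos i) (fun p => mem_rowPos),
    sum_map_of_nodup nodup_lowerPos (fun p => mem_lowerPos), ← Finset.sum_sub_distrib]
  have hp : ∀ p : Pos n, ((if p.2.1 = i ∧ p.2.2 ≠ i then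
        (expo A p : ℤ) * SchurData.root p.2.1 p.2.2 i else 0) -
      if p.2.2 < p.2.1 then (expo A p : ℤ) * SchurData.root p.2.1 p.2.2 i else 0) =
      (if p.2.1 = i ∧ i < p.2.2 then (expo A p : ℤ) else 0) +
        if p.2.2 = i ∧ i < p.2.1 then (expo A p : ℤ) else 0 := by
    rintro ⟨e, a, b⟩
    simp only [SchurData.root, Pi.sub_apply, Pi.single_apply]
    by_cases ha : a = i <;> by_cases hb : b = i <;> grind
  rw [Finset.sum_congr rfl fun p _ => hp p, Fintype.sum_prod_type]
  simp only [Fintype.sum_prod_type]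
  rw [Fintype.sum_bool, h, h, chi]
  simp only [expo, entry]
  push_cast
  rw [← Finset.sum_add_distrib]
  have : ∀ j, ((A.2 i j : ℕ) : ℤ) + (A.2 j i : ℕ) + ((A.1 i j : ℤ) + A.1 j i) =
    A.1 i j + (A.2 i j : ℕ) + (A.1 j i + (A.2 j i : ℕ)) := fun j => by ring
  simp only [this]
  ring

end Positions

/-! ### Straightening words into the elements $\mathfrak u_{(C,\lambda)}$. -/

namespace SchurData

variable {n r : ℕ} {R : Type*} [Ring R] [Algebra ℚ R] (D : SchurData n r R)

theorem ev_word_zero (P : List (Pos n)) : D.ev (word P 0) = 1 := by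
  induction P with
  | nil => rfl
  | cons p P ih =>
    rw [show word (p :: P) 0 = (p, 0) :: word P 0 from rfl, ev_cons, ih, val_zero, one_mul]

theorem ev_word_eq_zero {P : List (Pos n)} {C : Pos n → ℕ} {p : Pos n} (hp : p ∈ P)
    (h : D.val (p, C p) = 0) : D.ev (word P C) = 0 := by
  apply List.prod_eq_zero
  rw [← h]
  exact List.mem_map_of_mem (List.mem_map_of_mem hp)

/-- Every word is an integral multiple of an ordered word, up to words of lower degree. -/
theorem exists_ordered (w : List (Letter n)) : ∃ (C : Pos n → ℕ) (k : ℤ),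
    D.ev w - k • D.ev (word (allPos n) C) ∈ D.filt (degree w) ∧
      (k = 0 ∨ degree (word (allPos n) C) = degree w) := by
  induction w with
  | nil =>
    refine ⟨0, 1, ?_, Or.inr ?_⟩
    · rw [ev_word_zero]; simp
    · simp [degree, word, Function.comp_def]
  | cons u w ih =>
    obtain ⟨p, a⟩ := u
    obtain ⟨C, k, hk, hdeg⟩ := ih
    have hk' := ev_mul_mem_filt hk [(p, a)]
    by_cases hp : p ∈ allPos n
    swap
    · rcases Nat.eq_zero_or_pos a with rfl | ha
      · exact ⟨C, k, by simpa using hk', by simpa using hdeg⟩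
      · refine ⟨0, 0, ?_, Or.inl rfl⟩
        rw [mem_allPos] at hp
        obtain ⟨_ | _, i, j⟩ := p
        · obtain rfl : i = j := by simpa using hp
          simp [val_even_self _ _ ha.ne']
        · simp at hp
    rcases hdeg with rfl | hdeg
    · refine ⟨0, 0, ?_, Or.inl rfl⟩
      simpa using hk'
    set rest := (allPos n).erase p
    -- The new letter meets its own position: that position is brought to the front, merged with the
    -- letter, and put back in order.
    have hperm : (allPos n).Perm (p :: rest) := List.perm_cons_erase hp
    have hrest : word rest (Function.update C p (a + C p)) = word rest C := by
      apply List.map_congr_left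
      intro q hq
      rw [Function.update_of_ne]
      rintro rfl
      exact nodup_allPos.not_mem_erase hq
    obtain ⟨ε₁, h1⟩ := D.exists_of_perm (word_perm hperm C)
    obtain ⟨m, h2⟩ := D.exists_merge p a (C p)
    obtain ⟨ε₂, h3⟩ := D.exists_of_perm (word_perm hperm.symm (Function.update C p (a + C p)))
    have hw : word (p :: rest) (Function.update C p (a + C p)) =
        (p, a + C p) :: word rest C := by
      rw [← hrest]; simp [word]
    have hw' : word (p :: rest) C = (p, C p) :: word rest C := rfl
    have d1 : degree (word (allPos n) C) = C p + degree (word rest C) := by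
      rw [degree_perm (word_perm hperm C), hw', degree_cons]
    rw [hw] at h3
    rw [hw'] at h1
    simp only [ev_cons, degree_cons] at h1 h3
    refine ⟨Function.update C p (a + C p), k * ε₁ * m * ε₂, ?_, Or.inr ?_⟩
    · have g1 := ev_mul_mem_filt h1 [(p, a)]
      have g2 := mul_mem_filt' h2 (ev_mem_filt (D := D) (w := word rest C) (Nat.lt_succ_self _))
      rw [degree_cons, ← hdeg]
      rw [← hdeg] at hk'
      simp only [degree_cons, degree_nil, d1, add_zero, ev_cons, ev_nil, mul_one, ← add_assoc]
        at hk' g1 g2 h3 ⊢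
      -- The errors of ordering `w`, extracting `p`, merging and reordering telescope.
      have := add_mem (add_mem (add_mem hk' (Submodule.smul_mem _ k g1))
        (Submodule.smul_mem _ (k * ε₁) g2)) (Submodule.smul_mem _ (k * ε₁ * m) h3)
      convert this using 1
      simp only [Units.smul_def, mul_sub, sub_mul, mul_smul_comm, smul_mul_assoc, mul_assoc]
      module
    · rw [degree_perm (word_perm hperm _), hw, degree_cons, degree_cons, ← hdeg, d1]
      simp only
      ring

/-- Ordered words vanish modulo words of lower degree on small weights. -/
theorem proj_mul_ev_word_mem (C : Pos n → ℕ) (i : Fin n) (hC : C (true, i, i) ≤ 1)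
    (μ : Fin n → ℤ) (h : μ i - wordWeight (word (rowPos i) C) i < C (true, i, i)) :
    D.proj μ * D.ev (word (allPos n) C) ∈ D.filt (degree (word (allPos n) C)) := by
  set B := (allPos n).filter fun p => !decide (p.2.1 = i ∧ p.2.2 ≠ i) with hB
  have hmem : (true, i, i) ∈ B := by
    rw [hB, List.mem_filter, mem_allPos]; simp
  -- Row `i` comes first and the odd Cartan letter at `i` immediately after it.
  have hperm : (allPos n).Perm (rowPos i ++ (true, i, i) :: B.erase (true, i, i)) :=
    (List.filter_append_perm (fun p => decide (p.2.1 = i ∧ p.2.2 ≠ i)) (allPos n)).symm.trans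
      ((List.perm_cons_erase hmem).append_left _)
  obtain ⟨ε, hε⟩ := D.exists_of_perm (word_perm hperm C)
  have hε' := proj_mul_mem_filt hε μ
  have hw : word (rowPos i ++ (true, i, i) :: B.erase (true, i, i)) C =
    word (rowPos i) C ++ ((true, i, i), C (true, i, i)) :: word (B.erase (true, i, i)) C := by
    simp [word]
  set ν := μ - wordWeight (word (rowPos i) C) with hν
  -- Past row `i` the weight is `ν`, with `ν i < C (true, i, i) ≤ 1`. Either `ν i` is negative, or
  -- it is 0 and the odd Cartan element is present.
  have key : D.proj ν * D.val ((true, i, i), C (true, i, i)) = 0 := by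
    by_cases hneg : ν i < 0
    · rw [D.proj_eq_zero hneg, zero_mul]
    · have hνi : ν i = μ i - wordWeight (word (rowPos i) C) i := rfl
      have h1 : C (true, i, i) = 1 := by lia
      have h0 : ν i = 0 := by lia
      rw [h1, val_odd_one, (D.hasWeight_Y i i).mul_proj, D.Y_cartan_mul_proj]
      simpa [root] using h0
  rw [mul_sub, Units.smul_def, mul_smul_comm, hw, ev_append, ev_cons, ← mul_assoc,
    (D.hasWeight_ev (word (rowPos i) C)).mul_proj, mul_assoc, ← mul_assoc (D.proj _), key] at hε'
  simpa using hε'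

/-- The image of `uLift`. -/
def basisElt (C : SMat n) (lam : Fin n → ℕ) : R :=
  D.ev (word (lowerPos n) (expo C)) * D.cartanBinom lam * D.ev (word (diagPos n) (expo C)) *
    D.ev (word (upperPos n) (expo C))

/-- The `ℤ`-span of the elements `u_{(C,λ)}` with `χ(C) ⪯ λ`. -/
def basisSpan : Submodule ℤ R :=
  Submodule.span ℤ {z | ∃ C ∈ SMat' n, ∃ lam ∈ Comp n r, (∀ i, chi C i ≤ lam i) ∧
    z = D.basisElt C lam}

-- Moved inward to the end of the lower part, the projection becomes $1_\lambda$ or zero. Then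
-- either $\chi(C)\preceq\lambda$ and the product is a spanning element, or an index where this
-- fails makes the word fall into lower degree.
variable {D} in
theorem ev_word_mul_proj_mem {C : SMat n} (hC : C ∈ SMat' n)
    (h : D.filt (degree (word (allPos n) (expo C))) ≤ D.basisSpan) (μ : Fin n → ℤ) :
    D.ev (word (allPos n) (expo C)) * D.proj μ ∈ D.basisSpan := by
  have hword : word (allPos n) (expo C) = word (lowerPos n) (expo C) ++
    (word (diagPos n) (expo C) ++ word (upperPos n) (expo C)) := by simp [word, allPos]
  set u := word (diagPos n) (expo C) ++ word (upperPos n) (expo C)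
  have h1 : D.ev (word (allPos n) (expo C)) * D.proj μ =
      D.ev (word (lowerPos n) (expo C)) * D.proj (μ + wordWeight u) * D.ev u := by
    rw [hword, ev_append, mul_assoc, mul_assoc, (D.hasWeight_ev u).proj_mul]
  rw [h1]
  by_cases h0 : D.proj (μ + wordWeight u) = 0
  · simp [h0]
  obtain ⟨lam, hlam, hμ⟩ := D.exists_of_proj_ne_zero h0
  rw [hμ]
  by_cases hchi : ∀ i, chi C i ≤ lam i
  · refine Submodule.subset_span ⟨C, hC, lam, hlam, hchi, ?_⟩
    rw [D.proj_natCast hlam, ev_append, basisElt, mul_assoc _ (D.ev _) (D.ev _)]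
  · push Not at hchi
    obtain ⟨i, hi⟩ := hchi
    apply h
    -- The projection goes to the far left, where its weight is `lam` plus the weight of the lower
    -- part.
    rw [← (D.hasWeight_ev _).proj_mul, mul_assoc, ← ev_append, ← hword]
    apply D.proj_mul_ev_word_mem (expo C) i (by simp only [expo]; lia)
    have := wordWeight_sub_wordWeight C i
    have h2 := hC i
    simp only [Pi.add_apply, expo, entry, h2] at this ⊢
    push_cast at this
    lia

/-- Induction on the degree: a word is replaced by an integral multiple of an ordered word, and all
errors have lower degree. -/
theorem filt_le_basisSpan (d : ℕ) : D.filt d ≤ D.basisSpan := by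
  induction d with
  | zero => simp [filt]
  | succ d ih =>
    apply Submodule.span_le.2
    rintro _ ⟨w, μ, hw, rfl⟩
    obtain ⟨C, k, h1, h2⟩ := D.exists_ordered w
    have hle : D.filt (degree w) ≤ D.basisSpan := (filt_mono (by lia)).trans ih
    have h3 : D.ev w * D.proj μ = (D.ev w - k • D.ev (word (allPos n) C)) * D.proj μ +
        k • (D.ev (word (allPos n) C) * D.proj μ) := by
      rw [sub_mul, smul_mul_assoc, sub_add_cancel]
    have h4 : D.proj μ ∈ D.filt 1 := by
      simpa using ev_mul_proj_mem (D := D) (w := []) (by simp) μ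
    rw [SetLike.mem_coe, h3]
    have h5 := mul_mem_filt' (e := 0) h1 h4
    refine add_mem (hle h5) ?_
    rcases h2 with rfl | h2
    · rw [zero_smul]; exact zero_mem _
    apply Submodule.smul_mem
    by_cases hodd : ∃ i j, 1 < C (true, i, j)
    · obtain ⟨i, j, hij⟩ := hodd
      rw [D.ev_word_eq_zero (p := (true, i, j)) (mem_allPos.2 (Or.inl rfl))
        (D.val_odd_of_lt i j hij), zero_mul]
      exact zero_mem _
    · push Not at hodd
      -- The even diagonal exponents of `C` are arbitrary but never read by `allPos`, so they may be
      -- set to 0.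
      let A : SMat n := (fun i j => if i = j then 0 else C (false, i, j),
        fun i j => ⟨C (true, i, j), Nat.lt_succ_of_le (hodd i j)⟩)
      have hA : word (allPos n) C = word (allPos n) (expo A) := by
        apply List.map_congr_left
        rintro ⟨_ | _, i, j⟩ hp
        · rw [mem_allPos] at hp
          have : i ≠ j := by simpa using hp
          simp [expo, A, this]
        · simp [expo, A]
      rw [hA] at h2 ⊢
      apply ev_word_mul_proj_mem (fun i => if_pos rfl)
      rwa [h2]

end SchurData

/-! ### The defining relations of `U` on root vectors. -/

section Relations

variable {n : ℕ}

/-- The matrix `E_{i,j} + E_{-i,-j}`. -/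
def evenMat (i j : Fin n) : queer n :=
  ⟨Matrix.fromBlocks (Matrix.single i j 1) 0 0 (Matrix.single i j 1), _, _, rfl⟩

/-- The matrix `E_{i,-j} + E_{-i,j}`. -/
def oddMat (i j : Fin n) : queer n :=
  ⟨Matrix.fromBlocks 0 (Matrix.single i j 1) (Matrix.single i j 1) 0, _, _, rfl⟩

theorem single_mul_single_ite (i j k l : Fin n) :
    (Matrix.single i j 1 * Matrix.single k l 1 : Matrix (Fin n) (Fin n) ℚ) =
      if j = k then Matrix.single i l 1 else 0 := by
  split_ifs with h
  · subst h; simp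
  · simp [Matrix.single_mul_single_of_ne _ _ _ _ h]

theorem evenMat_mul_evenMat (i j k l : Fin n) :
    evenMat i j * evenMat k l = if j = k then evenMat i l else 0 := by
  apply Subtype.ext
  rw [Subalgebra.coe_mul]
  simp only [evenMat, Matrix.fromBlocks_multiply, single_mul_single_ite]
  split_ifs <;> simp

theorem evenMat_mul_oddMat (i j k l : Fin n) :
    evenMat i j * oddMat k l = if j = k then oddMat i l else 0 := by
  apply Subtype.ext
  rw [Subalgebra.coe_mul]
  simp only [evenMat, oddMat, Matrix.fromBlocks_multiply, single_mul_single_ite]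
  split_ifs <;> simp

theorem oddMat_mul_evenMat (i j k l : Fin n) :
    oddMat i j * evenMat k l = if j = k then oddMat i l else 0 := by
  apply Subtype.ext
  rw [Subalgebra.coe_mul]
  simp only [evenMat, oddMat, Matrix.fromBlocks_multiply, single_mul_single_ite]
  split_ifs <;> simp

theorem oddMat_mul_oddMat (i j k l : Fin n) :
    oddMat i j * oddMat k l = if j = k then evenMat i l else 0 := by
  apply Subtype.ext
  rw [Subalgebra.coe_mul]
  simp only [evenMat, oddMat, Matrix.fromBlocks_multiply, single_mul_single_ite]
  split_ifs <;> simp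

/-- The canonical map `q(n) → U(q(n))` as a linear map. -/
def toULinear : queer n →ₗ[ℚ] U n :=
  (RingQuot.mkAlgHom ℚ (EnvRel n)).toLinearMap ∘ₗ TensorAlgebra.ι ℚ

theorem x_eq (i j : Fin n) : x i j = toULinear (evenMat i j) := rfl

theorem xbar_eq (i j : Fin n) : xbar i j = toULinear (oddMat i j) := rfl

theorem toULinear_ite (P : Prop) [Decidable P] (X : queer n) :
    toULinear (if P then X else 0) = if P then toULinear X else 0 := by
  split_ifs <;> simp

theorem toULinear_mul {a b : Fin 2} {u v : queer n} (hu : IsHomogeneous a u)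
    (hv : IsHomogeneous b v) : toULinear u * toULinear v =
      (-1 : ℚ) ^ ((a : ℕ) * (b : ℕ)) • (toULinear v * toULinear u) +
        toULinear (superBracket a b u v) := by
  have h := RingQuot.mkAlgHom_rel ℚ (EnvRel.comm a b u v hu hv)
  rw [map_sub, map_smul, map_mul, map_mul] at h
  rw [← sub_eq_iff_eq_add']
  exact h

theorem isHomogeneous_evenMat (i j : Fin n) : IsHomogeneous 0 (evenMat i j) := by
  rw [IsHomogeneous, if_pos rfl]; exact ⟨_, rfl⟩

theorem isHomogeneous_oddMat (i j : Fin n) : IsHomogeneous 1 (oddMat i j) := by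
  rw [IsHomogeneous, if_neg (by decide)]; exact ⟨_, rfl⟩

theorem x_mul_x (i j k l : Fin n) : (x i j * x k l : U n) = x k l * x i j +
    ((if j = k then x i l else 0) - (if i = l then x k j else 0)) := by
  simp only [x_eq]
  rw [toULinear_mul (isHomogeneous_evenMat i j) (isHomogeneous_evenMat k l)]
  simp [superBracket, evenMat_mul_evenMat, toULinear_ite, eq_comm]

theorem x_mul_xbar (i j k l : Fin n) : (x i j * xbar k l : U n) = xbar k l * x i j +
    ((if j = k then xbar i l else 0) - (if i = l then xbar k j else 0)) := by
  simp only [x_eq, xbar_eq]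
  rw [toULinear_mul (isHomogeneous_evenMat i j) (isHomogeneous_oddMat k l)]
  simp [superBracket, evenMat_mul_oddMat, oddMat_mul_evenMat, toULinear_ite, eq_comm]

theorem xbar_mul_xbar (i j k l : Fin n) : (xbar i j * xbar k l : U n) = -(xbar k l * xbar i j) +
    ((if j = k then x i l else 0) + (if i = l then x k j else 0)) := by
  simp only [x_eq, xbar_eq]
  rw [toULinear_mul (isHomogeneous_oddMat i j) (isHomogeneous_oddMat k l)]
  simp [superBracket, oddMat_mul_oddMat, toULinear_ite, eq_comm]
  split_ifs <;> module

end Relations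

/-! ### All root vectors lie in the integral form. -/

section IntegralForm

variable {n : ℕ}

theorem divPow_eq (y : U n) (k : ℕ) : divPow y k = dpz y k := (dpz_natCast y k).symm

/-- With both exponents equal to `m`, the last term of the Heisenberg formula is the `m`-th divided
power of `x i l`; the others involve only smaller ones, which strong induction covers. -/
theorem dpz_mem_trans {i j l : Fin n} (hij : i ≠ j) (hjl : j ≠ l) (hil : i ≠ l)
    (h₁ : ∀ k : ℤ, dpz (x i j) k ∈ UZ n) (h₂ : ∀ k : ℤ, dpz (x j l) k ∈ UZ n) (k : ℤ) :
    dpz (x i l) k ∈ UZ n := by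
  rcases lt_or_ge k 0 with hk | hk
  · rw [dpz_of_neg _ hk]; exact zero_mem _
  lift k to ℕ using hk
  induction k using Nat.strong_induction_on with
  | _ m ih =>
    have h := dpz_mul_dpz_of_heisenberg (y := x i j) (z := x j l) (c := x i l)
      (by rw [x_mul_x]; simp [hil])
      (by rw [Commute, SemiconjBy, x_mul_x]; simp [hij.symm, hil])
      (by rw [Commute, SemiconjBy, x_mul_x]; simp [hil.symm, hjl]) m m
    rw [Finset.sum_range_succ, sub_self, dpz_zero, dpz_zero, one_mul, mul_one] at h
    rw [← sub_eq_iff_eq_add'.2 h]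
    refine sub_mem (mul_mem (h₁ _) (h₂ _)) (sum_mem fun t ht => ?_)
    exact mul_mem (mul_mem (h₂ _) (ih t (Finset.mem_range.1 ht))) (h₁ _)

theorem xbar_mem_trans {i j l : Fin n} (hil : i ≠ l) (h₁ : x i j ∈ UZ n)
    (h₂ : xbar j l ∈ UZ n) : xbar i l ∈ UZ n := by
  have h := x_mul_xbar i j j l
  rw [if_pos rfl, if_neg hil, sub_zero] at h
  rw [← sub_eq_iff_eq_add'.2 h]
  exact sub_mem (mul_mem h₁ h₂) (mul_mem h₂ h₁)

theorem root_mem_of_simple {i j : Fin n} (hij : (i : ℕ) + 1 = j) :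
    (∀ k : ℤ, dpz (x i j) k ∈ UZ n) ∧ (∀ k : ℤ, dpz (x j i) k ∈ UZ n) ∧
      xbar i j ∈ UZ n ∧ xbar j i ∈ UZ n := by
  have key : ∀ y : U n, (∀ k : ℕ, divPow y k ∈ UZ n) → ∀ k : ℤ, dpz y k ∈ UZ n := by
    intro y hy k
    rcases lt_or_ge k 0 with hk | hk
    · rw [dpz_of_neg _ hk]; exact zero_mem _
    · lift k to ℕ using hk
      rw [← divPow_eq]; exact hy k
  refine ⟨key _ fun k => ?_, key _ fun k => ?_, ?_, ?_⟩ <;> apply Subring.subset_closure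
  · exact Or.inl (Or.inl (Or.inl ⟨i, j, k, hij, Or.inl rfl⟩))
  · exact Or.inl (Or.inl (Or.inl ⟨i, j, k, hij, Or.inr rfl⟩))
  · exact Or.inl (Or.inl (Or.inr ⟨i, j, hij, Or.inl rfl⟩))
  · exact Or.inl (Or.inl (Or.inr ⟨i, j, hij, Or.inr rfl⟩))

/-- All divided powers of root vectors and all odd root vectors lie in the integral form. -/
theorem root_mem (d : ℕ) (i l : Fin n) (h : (i : ℕ) + (d + 1) = l) :
    (∀ k : ℤ, dpz (x i l) k ∈ UZ n) ∧ (∀ k : ℤ, dpz (x l i) k ∈ UZ n) ∧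
      xbar i l ∈ UZ n ∧ xbar l i ∈ UZ n := by
  induction d generalizing i with
  | zero => exact root_mem_of_simple h
  | succ d ih =>
    let j : Fin n := ⟨i + 1, by have := l.2; lia⟩
    have hj : (i : ℕ) + 1 = j := rfl
    obtain ⟨a1, a2, a3, a4⟩ := root_mem_of_simple hj
    obtain ⟨b1, b2, b3, b4⟩ := ih j (by lia)
    have hij : i ≠ j := by rw [Ne, Fin.ext_iff]; lia
    have hjl : j ≠ l := by rw [Ne, Fin.ext_iff]; lia
    have hil : i ≠ l := by rw [Ne, Fin.ext_iff]; lia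
    refine ⟨dpz_mem_trans hij hjl hil a1 b1, dpz_mem_trans hjl.symm hij.symm hil.symm b2 a2,
      xbar_mem_trans hil ?_ b3, xbar_mem_trans hil.symm ?_ a4⟩
    · simpa using a1 1
    · simpa using b2 1

theorem factor_mem (A : SMat n) {i j : Fin n} (hij : i ≠ j) : factor A i j ∈ UZ n := by
  rw [factor, divPow_eq]
  rcases lt_or_gt_of_ne hij with h | h
  · obtain ⟨h1, -, h2, -⟩ := root_mem (j - i - 1) i j (by rw [Fin.lt_def] at h; lia)
    exact mul_mem (h1 _) (pow_mem h2 _)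
  · obtain ⟨-, h1, -, h2⟩ := root_mem (i - j - 1) j i (by have := Fin.lt_def.1 h; lia)
    exact mul_mem (h1 _) (pow_mem h2 _)

theorem list_prod_map_mem {ι : Type*} {L : List ι} {f : ι → U n} (h : ∀ a ∈ L, f a ∈ UZ n) :
    (L.map f).prod ∈ UZ n :=
  list_prod_mem (by simpa using h)

theorem uLift_mem (C : SMat n) (lam : Fin n → ℕ) : uLift C lam ∈ UZ n := by
  refine mul_mem (mul_mem (mul_mem ?_ ?_) ?_) ?_
  · refine list_prod_map_mem fun j _ => list_prod_map_mem fun l hl => factor_mem C ?_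
    simp only [List.mem_reverse, List.mem_filter, decide_eq_true_eq] at hl
    exact hl.2.ne'
  · refine list_prod_map_mem fun i _ => ?_
    apply Subring.subset_closure
    exact Or.inl (Or.inr ⟨i, lam i, rfl⟩)
  · refine list_prod_map_mem fun i _ => pow_mem ?_ _
    apply Subring.subset_closure
    exact Or.inr ⟨i, rfl⟩
  · refine list_prod_map_mem fun j _ => list_prod_map_mem fun l hl => factor_mem C ?_
    simp only [List.mem_filter, decide_eq_true_eq] at hl
    exact hl.2.ne

end IntegralForm

/-! ### Transfer between `U / I` and `UZnr`. -/

section Quotient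

variable (n r : ℕ)

/-- The quotient map `U → U / I`. -/
def toQuot : U n →ₐ[ℚ] (idealI n r).ringCon.Quotient := (idealI n r).ringCon.mkₐ ℚ

variable {n r}

theorem toQuot_eq_iff {u v : U n} : toQuot n r u = toQuot n r v ↔ u - v ∈ idealI n r := by
  rw [← TwoSidedIdeal.rel_iff]
  exact RingCon.eq _

theorem toQuot_eq_zero {u : U n} (h : u ∈ idealI n r) : toQuot n r u = 0 := by
  rw [← map_zero (toQuot n r), toQuot_eq_iff, sub_zero]; exact h

/-- `idealIZ` is the preimage of `idealI`, so `UZnr` embeds in `U / I` and equalities can be checked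
there. -/
theorem toUZnr_eq_iff {u v : UZ n} :
    toUZnr n r u = toUZnr n r v ↔ toQuot n r u = toQuot n r v := by
  rw [toQuot_eq_iff]
  refine (RingCon.eq _).trans ((TwoSidedIdeal.rel_iff _ _ _).trans ?_)
  rw [idealIZ, TwoSidedIdeal.mem_comap]
  simp

theorem map_ite_zero {A B : Type*} [Semiring A] [Semiring B] [Algebra ℚ A] [Algebra ℚ B]
    (f : A →ₐ[ℚ] B) (P : Prop) [Decidable P] (y : A) :
    f (if P then y else 0) = if P then f y else 0 := by
  split_ifs <;> simp

variable (n r) in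
/-- The images of the root vectors in `U / I`. -/
def quotData : SchurData n r (idealI n r).ringCon.Quotient where
  X i j := toQuot n r (x i j)
  Y i j := toQuot n r (xbar i j)
  XX i j k l := by
    rw [← map_mul, x_mul_x, map_add, map_mul, map_sub, map_ite_zero, map_ite_zero]
  XY i j k l := by
    rw [← map_mul, x_mul_xbar, map_add, map_mul, map_sub, map_ite_zero, map_ite_zero]
  YY i j k l := by
    rw [← map_mul, xbar_mul_xbar, map_add, map_neg, map_mul, map_add, map_ite_zero, map_ite_zero]
  sum_X := by
    rw [← map_sum, ← map_natCast (toQuot n r), toQuot_eq_iff]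
    exact TwoSidedIdeal.subset_span (Or.inl rfl)
  cartan i := by
    have h : toQuot n r (hbar i * ((List.range r).map fun t => h i - ((t + 1 : ℕ) : U n)).prod) = 0 :=
      toQuot_eq_zero (TwoSidedIdeal.subset_span (Or.inr ⟨i, rfl⟩))
    rw [map_mul, map_list_prod, List.map_map] at h
    rw [← h]
    congr 3

theorem toQuot_divPow (y : U n) (k : ℕ) : toQuot n r (divPow y k) = dpz (toQuot n r y) k := by
  rw [divPow, dpz_natCast, map_smul, map_pow]

theorem toQuot_binom (y : U n) (k : ℕ) : toQuot n r (binom y k) = binomial (toQuot n r y) k := by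
  rw [binom, binomial, map_smul, map_list_prod, falling, List.map_map]
  congr 2
  simp [Function.comp_def, List.map_eq_flatMap, List.flatMap_assoc]

theorem toQuot_factor (A : SMat n) {i j : Fin n} (hij : i ≠ j) : toQuot n r (factor A i j) =
    (quotData n r).val ((false, i, j), A.1 i j) * (quotData n r).val ((true, i, j), A.2 i j) := by
  have : (A.2 i j : ℕ) ≤ 1 := by lia
  rw [factor, map_mul, toQuot_divPow, map_pow, SchurData.val_even _ hij, SchurData.val, if_pos this]
  rfl

theorem prod_map_flatMap {α β M : Type*} [Monoid M] (L : List α) (f : α → List β) (g : β → M) :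
    ((L.flatMap f).map g).prod = (L.map fun a => ((f a).map g).prod).prod := by
  induction L with
  | nil => rfl
  | cons a L ih => simp [ih]

theorem toQuot_uLift (C : SMat n) (lam : Fin n → ℕ) :
    toQuot n r (uLift C lam) = (quotData n r).basisElt C lam := by
  rw [uLift, map_mul, map_mul, map_mul, SchurData.basisElt]
  congr 1
  · congr 1
    · congr 1
      · rw [SchurData.ev, word, List.map_map, lowerPos, prod_map_flatMap, fMinus, map_list_prod,
          List.map_map]
        congr 2
        funext j
        rw [prod_map_flatMap, Function.comp_apply, colProd, map_list_prod, List.map_map]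
        congr 1
        apply List.map_congr_left
        intro l hl
        simp only [List.mem_reverse, List.mem_filter, decide_eq_true_eq] at hl
        rw [Function.comp_apply, toQuot_factor C hl.2.ne']
        simp [expo]
      · rw [hBinom, map_list_prod, List.map_map, SchurData.cartanBinom]
        congr 2
        funext i
        exact toQuot_binom _ _
    · rw [SchurData.ev, word, List.map_map, diagPos, List.map_map, hbarProd, map_list_prod,
        List.map_map]
      congr 2
      funext i
      have : (C.2 i i : ℕ) ≤ 1 := by lia
      simp only [Function.comp_apply, expo, SchurData.val, this, if_true, map_pow]
      rfl
  · rw [SchurData.ev, word, List.map_map, upperPos, prod_map_flatMap, ePlus, map_list_prod,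
      List.map_map]
    congr 2
    funext j
    rw [prod_map_flatMap, Function.comp_apply, rowProd, map_list_prod, List.map_map]
    congr 1
    apply List.map_congr_left
    intro l hl
    simp only [List.mem_filter, decide_eq_true_eq] at hl
    rw [Function.comp_apply, toQuot_factor C hl.2.ne]
    simp [expo]

/-- On a weight space the binomial acts by an integer binomial coefficient. -/
theorem binomial_cartan_mem_filt {R : Type*} [Ring R] [Algebra ℚ R] (D : SchurData n r R)
    (i : Fin n) (k : ℕ) : binomial (D.X i i) k ∈ D.filt 1 := by
  apply SchurData.mem_filt_of_mul_proj
  intro μ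
  by_cases h : D.proj μ = 0
  · simp [h]
  obtain ⟨b, hb, rfl⟩ := D.exists_of_proj_ne_zero h
  rw [binomial_mul_of_eigen (m := b i) (by rw [D.cartan_mul_proj]; simp), Nat.cast_smul_eq_nsmul]
  apply nsmul_mem
  simpa using SchurData.ev_mul_proj_mem (D := D) (w := []) (d := 1) (by simp) (fun i => (b i : ℤ))

/-- The filtration exhausts the image of `UZ`: each generator has finite degree, and products stay
in the filtration. -/
theorem exists_mem_filt {y : U n} (hy : y ∈ UZ n) :
    ∃ d, toQuot n r y ∈ (quotData n r).filt d := by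
  induction hy using Subring.closure_induction with
  | mem y hy =>
    have key : ∀ i j : Fin n, (i : ℕ) + 1 = j → i ≠ j := by
      rintro i _ h rfl; lia
    rcases hy with ((⟨i, j, k, hij, rfl | rfl⟩ | ⟨i, j, -, rfl | rfl⟩) | ⟨i, k, rfl⟩) | ⟨i, rfl⟩
    · refine ⟨k + 1, ?_⟩
      rw [toQuot_divPow]
      exact (quotData n r).dpz_mem_filt (key i j hij) (by lia)
    · refine ⟨k + 1, ?_⟩
      rw [toQuot_divPow]
      exact (quotData n r).dpz_mem_filt (key i j hij).symm (by lia)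
    · exact ⟨2, (quotData n r).Y_mem_filt i j⟩
    · exact ⟨2, (quotData n r).Y_mem_filt j i⟩
    · refine ⟨1, ?_⟩
      rw [toQuot_binom]
      exact binomial_cartan_mem_filt (quotData n r) i k
    · exact ⟨2, (quotData n r).Y_mem_filt i i⟩
  | zero => exact ⟨0, by rw [map_zero]; exact zero_mem _⟩
  | one => exact ⟨1, by rw [map_one, ← SchurData.ev_nil]; exact SchurData.ev_mem_filt (by simp)⟩
  | add y z _ _ hy hz =>
    obtain ⟨d, hd⟩ := hy
    obtain ⟨e, he⟩ := hz
    refine ⟨d + e, ?_⟩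
    rw [map_add]
    exact add_mem (SchurData.filt_mono (by lia) hd) (SchurData.filt_mono (by lia) he)
  | neg y _ hy =>
    obtain ⟨d, hd⟩ := hy
    exact ⟨d, by rw [map_neg]; exact neg_mem hd⟩
  | mul y z _ _ hy hz =>
    obtain ⟨d, hd⟩ := hy
    obtain ⟨e, he⟩ := hz
    refine ⟨d + e, ?_⟩
    rw [map_mul]
    exact SchurData.mul_mem_filt' hd (SchurData.filt_mono (by lia) he)

/-- An integral combination in `U / I` is lifted term by term to `UZ`, where its class in `UZnr` is
visibly in the span. -/
theorem exists_lift_of_mem_basisSpan {z : (idealI n r).ringCon.Quotient}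
    (hz : z ∈ (quotData n r).basisSpan) :
    ∃ v : UZ n, toQuot n r v = z ∧ toUZnr n r v ∈ Submodule.span ℤ (spanningSet n r) := by
  induction hz using Submodule.span_induction with
  | mem z hz =>
    obtain ⟨C, hC, lam, hlam, hchi, rfl⟩ := hz
    exact ⟨⟨uLift C lam, uLift_mem C lam⟩, toQuot_uLift C lam,
      Submodule.subset_span ⟨C, hC, lam, hlam, hchi, uLift_mem C lam, rfl⟩⟩
  | zero => exact ⟨0, by simp, by simp⟩
  | add y z _ _ hy hz =>
    obtain ⟨u, hu, hu'⟩ := hy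
    obtain ⟨v, hv, hv'⟩ := hz
    exact ⟨u + v, by simp [hu, hv], by rw [map_add]; exact add_mem hu' hv'⟩
  | smul c y _ hy =>
    obtain ⟨u, hu, hu'⟩ := hy
    exact ⟨c • u, by rw [← hu, ← map_zsmul]; rfl, by rw [map_zsmul]; exact Submodule.smul_mem _ c hu'⟩

theorem span_spanningSet : Submodule.span ℤ (spanningSet n r) = ⊤ := by
  rw [eq_top_iff]
  intro y _
  obtain ⟨u, rfl⟩ : ∃ u, toUZnr n r u = y := RingCon.mk'_surjective _ y
  obtain ⟨d, hd⟩ := exists_mem_filt (r := r) u.2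
  obtain ⟨v, hv, hv'⟩ := exists_lift_of_mem_basisSpan ((quotData n r).filt_le_basisSpan d hd)
  rwa [← toUZnr_eq_iff.2 hv]

end Quotient

end QueerSchur

end

/-- All the elements `u_{(C,λ)}` are defined in `U_ℤ(n,r)`, that is, their lifts lie in `U_ℤ`, and
those with `χ(C) ⪯ λ` span `U_ℤ(n,r)` over `ℤ`. -/
theorem proposition4p10 (n r : ℕ) :
    (∀ C ∈ QueerSchur.SMat' n, ∀ lam ∈ QueerSchur.Comp n r,
      QueerSchur.uLift C lam ∈ QueerSchur.UZ n) ∧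
    Submodule.span ℤ (QueerSchur.spanningSet n r) = ⊤ :=
  ⟨fun C _ lam _ => QueerSchur.uLift_mem C lam, QueerSchur.span_spanningSet⟩
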